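/- Let $V$ be a Euclidean space of finite dimension $n$ and let $\Omega\subseteq V$ be a symmetric cone, i.e. an open convex cone that equals its open dual cone $\{y\in V : \langle x,y\rangle>0 \text{ for all nonzero } x\in\overline{\Omega}\}$ and on which $\mathcal G(\Omega)=\{g\in \mathrm{GL}(V): g\Omega=\Omega\}$ acts transitively. Let $\mathcal G_0(\Omega)=\mathcal K\mathcal A\mathcal N$, with $\mathcal K=\mathcal G_0(\Omega)\cap \mathrm O(V)$, be an Iwasawa decomposition of the identity component of $\mathcal G(\Omega)$, and let $\mathcal H=\mathcal A\mathcal N$. Let $\mathcal G=\mathcal H\ltimes V$ be the Lie group with composition $(h,x)(h_1,x_1)=(hh_1,hx_1+x)$, with Lie algebra $\mathfrak g$ and universal enveloping algebra $\mathcal U(\mathfrak g)$. Let $\mathcal S_\Omega$ be the closed subspace, with the subspace topology, of those functions $f$ in the Schwartz space $\mathcal S(V)$ of complex-valued functions whose Fourier transform $\widehat f(w)=(2\pi)^{-n/2}\int_V f(x)e^{-i\langle x,w\rangle}\,dx$ vanishes outside $\Omega$, and let $\pi$ be the representation of $\mathcal G$ on $\mathcal S_\Omega$ given by $$\pi(h,x)f(t)=\frac{1}{\sqrt{\det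 h}}\,f(h^{-1}(t-x)).$$ Then every $\psi\in\mathcal S_\Omega$ is a smooth vector for $\pi$, i.e. the map $g\mapsto\pi(g)\psi$ from $\mathcal G$ to the Fréchet space $\mathcal S_\Omega$ is smooth; thus $\mathcal S_\Omega$ is the space of smooth vectors of $(\pi,\mathcal S_\Omega)$. Moreover, for $X\in\mathfrak g$ and $\psi\in\mathcal S_\Omega$ the limit $$\pi^\infty(X)\psi=\frac{d}{dt}\Big|_{t=0}\pi(\exp(tX))\psi$$ exists in $\mathcal S_\Omega$, the map $X\mapsto\pi^\infty(X)$ is a representation of the Lie algebra $\mathfrak g$ on $\mathcal S_\Omega$ by complex-linear operators, and it extends uniquely to a representation of the algebra $\mathcal U(\mathfrak g)$ on $\mathcal S_\Omega$. -/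

import Mathlib

open scoped SchwartzMap Topology

attribute [local instance] LieRing.ofAssociativeRing

namespace SymCone

section Exponential

variable {E : Type*} [NormedAddCommGroup E] [NormedSpace ℝ E] [CompleteSpace E]

theorem exp_mul_exp_neg (X : E →L[ℝ] E) :
    NormedSpace.exp X * NormedSpace.exp (-X) = 1 := by
  let +nondep : NormedAlgebra ℚ (E →L[ℝ] E) := .restrictScalars ℚ ℝ _
  rw [← NormedSpace.exp_add_of_commute (Commute.neg_right (Commute.refl X))]
  simp

/-- The exponential of an endomorphism, as an element of `GL(E)`. -/
noncomputable def expUnit (X : E →L[ℝ] E) : (E →L[ℝ] E)ˣ where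
  val := NormedSpace.exp X
  inv := NormedSpace.exp (-X)
  val_inv := exp_mul_exp_neg X
  inv_val := by simpa using exp_mul_exp_neg (-X)

theorem exp_add_smul (X : E →L[ℝ] E) (s t : ℝ) :
    NormedSpace.exp ((s + t) • X) = NormedSpace.exp (s • X) * NormedSpace.exp (t • X) := by
  let +nondep : NormedAlgebra ℚ (E →L[ℝ] E) := .restrictScalars ℚ ℝ _
  rw [add_smul, NormedSpace.exp_add_of_commute]
  exact ((Commute.refl X).smul_left s).smul_right t

theorem continuous_exp_smul_apply (X : E →L[ℝ] E) (v : E) :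
    Continuous fun u : ℝ => NormedSpace.exp (u • X) v := by
  let +nondep : NormedAlgebra ℚ (E →L[ℝ] E) := .restrictScalars ℚ ℝ _
  have h : Continuous fun u : ℝ => NormedSpace.exp (u • X) :=
    NormedSpace.exp_continuous.comp (continuous_id.smul continuous_const)
  exact (ContinuousLinearMap.apply ℝ E v).continuous.comp h

theorem norm_exp_le (X : E →L[ℝ] E) : ‖NormedSpace.exp X‖ ≤ Real.exp ‖X‖ := by
  rw [NormedSpace.exp_eq_tsum ℝ, Real.exp_eq_exp_ℝ, NormedSpace.exp_eq_tsum_div]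
  have hs : Summable fun n : ℕ => ‖X‖ ^ n / (n.factorial : ℝ) := Real.summable_pow_div_factorial _
  refine tsum_of_norm_bounded hs.hasSum fun n => ?_
  rw [norm_smul, norm_inv, RCLike.norm_natCast, div_eq_inv_mul]
  rcases n with _ | n
  · simpa [ContinuousLinearMap.one_def] using ContinuousLinearMap.norm_id_le (𝕜 := ℝ) (E := E)
  · gcongr
    exact norm_pow_le' X n.succ_pos

theorem norm_pow_sub_pow_le (A B : E →L[ℝ] E) (M : ℝ) (hM : 1 ≤ M) (hA : ‖A‖ ≤ M) (hB : ‖B‖ ≤ M)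
    (n : ℕ) : ‖A ^ n - B ^ n‖ ≤ n * (M ^ n * ‖A - B‖) := by
  have h0 : (0 : ℝ) ≤ M := by linarith
  have hBn : ∀ n : ℕ, ‖B ^ n‖ ≤ M ^ n := by
    intro n
    induction n with
    | zero => simpa [ContinuousLinearMap.one_def] using ContinuousLinearMap.norm_id_le (𝕜 := ℝ) (E := E)
    | succ n ih =>
      rw [pow_succ, pow_succ]
      exact (norm_mul_le _ _).trans (by gcongr)
  induction n with
  | zero => simp
  | succ n ih =>
    have e : A ^ (n + 1) - B ^ (n + 1) = A * (A ^ n - B ^ n) + (A - B) * B ^ n := by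
      rw [pow_succ' A, pow_succ' B]; noncomm_ring
    rw [e]
    calc ‖A * (A ^ n - B ^ n) + (A - B) * B ^ n‖
        ≤ ‖A‖ * ‖A ^ n - B ^ n‖ + ‖A - B‖ * ‖B ^ n‖ :=
          (norm_add_le _ _).trans (add_le_add (norm_mul_le _ _) (norm_mul_le _ _))
      _ ≤ M * (n * (M ^ n * ‖A - B‖)) + ‖A - B‖ * M ^ n := by
          gcongr; exact hBn n
      _ ≤ M * (n * (M ^ n * ‖A - B‖)) + ‖A - B‖ * M ^ (n + 1) := by
          gcongr
          exact n.le_succ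
      _ = ((n + 1 : ℕ) : ℝ) * (M ^ (n + 1) * ‖A - B‖) := by push_cast; ring

/-- The Lie product formula. -/
theorem tendsto_exp_mul_exp_pow (X Y : E →L[ℝ] E) :
    Filter.Tendsto (fun n : ℕ => (NormedSpace.exp ((n : ℝ)⁻¹ • X) *
      NormedSpace.exp ((n : ℝ)⁻¹ • Y)) ^ n) Filter.atTop (𝓝 (NormedSpace.exp (X + Y))) := by
  let +nondep : NormedAlgebra ℚ (E →L[ℝ] E) := .restrictScalars ℚ ℝ _
  have hd : HasDerivAt (fun t : ℝ => NormedSpace.exp (t • X) * NormedSpace.exp (t • Y) -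
      NormedSpace.exp (t • (X + Y))) 0 (0 : ℝ) := by
    have h1 := hasDerivAt_exp_smul_const (𝕂 := ℝ) X (0 : ℝ)
    have h2 := hasDerivAt_exp_smul_const (𝕂 := ℝ) Y (0 : ℝ)
    have h3 := hasDerivAt_exp_smul_const (𝕂 := ℝ) (X + Y) (0 : ℝ)
    have h := (h1.mul h2).sub h3
    have e : NormedSpace.exp ((0 : ℝ) • X) * X * NormedSpace.exp ((0 : ℝ) • Y) +
        NormedSpace.exp ((0 : ℝ) • X) * (NormedSpace.exp ((0 : ℝ) • Y) * Y) -
        NormedSpace.exp ((0 : ℝ) • (X + Y)) * (X + Y) = 0 := by simp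
    rw [e] at h
    exact h
  have hl : Filter.Tendsto (fun n : ℕ => (n : ℝ) * ‖NormedSpace.exp ((n : ℝ)⁻¹ • X) *
      NormedSpace.exp ((n : ℝ)⁻¹ • Y) - NormedSpace.exp ((n : ℝ)⁻¹ • (X + Y))‖)
      Filter.atTop (𝓝 0) := by
    have h := hd.tendsto_slope_zero
    have hinv : Filter.Tendsto (fun n : ℕ => (n : ℝ)⁻¹) Filter.atTop (𝓝[≠] 0) := by
      rw [tendsto_nhdsWithin_iff]
      refine ⟨tendsto_inv_atTop_nhds_zero_nat, ?_⟩
      filter_upwards [Filter.eventually_gt_atTop 0] with n hn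
      have : (n : ℝ) ≠ 0 := by exact_mod_cast hn.ne'
      simpa using this
    have h' := (h.comp hinv).norm
    simp only [norm_zero] at h'
    refine h'.congr fun n => ?_
    simp [norm_smul]
  set M : ℝ := ‖X‖ + ‖Y‖ with hM
  have hM0 : 0 ≤ M := by positivity
  rw [tendsto_iff_norm_sub_tendsto_zero]
  have hl' := hl.const_mul (Real.exp M)
  rw [mul_zero] at hl'
  refine squeeze_zero' (Filter.Eventually.of_forall fun n => norm_nonneg _) ?_ hl'
  filter_upwards [Filter.eventually_gt_atTop 0] with n hn
  have hn' : (n : ℝ) ≠ 0 := by exact_mod_cast hn.ne'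
  have hexp : NormedSpace.exp (X + Y) = NormedSpace.exp ((n : ℝ)⁻¹ • (X + Y)) ^ n := by
    rw [← NormedSpace.exp_nsmul, ← Nat.cast_smul_eq_nsmul ℝ, smul_smul, mul_inv_cancel₀ hn',
      one_smul]
  have hnn : ‖((n : ℝ)⁻¹)‖ = (n : ℝ)⁻¹ := by simp
  have hk : Real.exp ((n : ℝ)⁻¹ * M) ^ n = Real.exp M := by
    rw [← Real.exp_nat_mul, ← mul_assoc, mul_inv_cancel₀ hn', one_mul]
  rw [hexp]
  refine (norm_pow_sub_pow_le _ _ (Real.exp ((n : ℝ)⁻¹ * M)) ?_ ?_ ?_ n).trans_eq ?_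
  · exact Real.one_le_exp (by positivity)
  · refine (norm_mul_le _ _).trans ?_
    refine (mul_le_mul (norm_exp_le _) (norm_exp_le _) (norm_nonneg _) (Real.exp_nonneg _)).trans ?_
    rw [← Real.exp_add, norm_smul, norm_smul, hnn, hM, mul_add]
  · refine (norm_exp_le _).trans (Real.exp_le_exp.2 ?_)
    rw [norm_smul, hnn]
    gcongr
    exact norm_add_le _ _
  · rw [hk]; ring

end Exponential

section Cone

variable {V : Type*} [NormedAddCommGroup V] [InnerProductSpace ℝ V]

/-- The open dual cone `{y | ⟪x, y⟫ > 0 for all nonzero x in the closure of Ω}`. -/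
def openDual (Ω : Set V) : Set V :=
  {y | ∀ x ∈ closure Ω, x ≠ 0 → 0 < inner ℝ x y}

/-- The automorphism group `G(Ω) = {g ∈ GL(V) | g Ω = Ω}`. -/
def coneAut (Ω : Set V) : Subgroup (V →L[ℝ] V)ˣ where
  carrier := {g | (g : V →L[ℝ] V) '' Ω = Ω}
  one_mem' := by simp
  mul_mem' := by
    intro a b ha hb
    change ((a : V →L[ℝ] V) ∘ (b : V →L[ℝ] V)) '' Ω = Ω
    rw [Set.image_comp, hb, ha]
  inv_mem' := by
    intro a ha
    change ((a⁻¹ : (V →L[ℝ] V)ˣ) : V →L[ℝ] V) '' Ω = Ω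
    conv_lhs => rw [← show (a : V →L[ℝ] V) '' Ω = Ω from ha]
    rw [← Set.image_comp]
    change (((a⁻¹ : (V →L[ℝ] V)ˣ) : V →L[ℝ] V) * (a : V →L[ℝ] V)) '' Ω = Ω
    rw [Units.inv_mul]
    exact Set.image_id Ω

variable (V) in
/-- A symmetric cone in the Euclidean space `V`: an open convex cone which is self-dual and on
which its automorphism group acts transitively. -/
structure SymmetricCone where
  carrier : Set V
  isOpen : IsOpen carrier
  convex : Convex ℝ carrier
  smul_mem : ∀ c : ℝ, 0 < c → ∀ x ∈ carrier, c • x ∈ carrier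
  self_dual : carrier = openDual carrier
  transitive : ∀ x ∈ carrier, ∀ y ∈ carrier, ∃ g ∈ coneAut carrier, (g : V →L[ℝ] V) x = y

theorem interior_closure_eq {Ω : Set V} (ho : IsOpen Ω) (hc : Convex ℝ Ω) :
    interior (closure Ω) = Ω := by
  rcases Ω.eq_empty_or_nonempty with rfl | hne
  · simp
  · rw [hc.interior_closure_eq_interior_of_nonempty_interior (by rwa [ho.interior_eq]),
      ho.interior_eq]

theorem mapsTo_closure_of_mem_coneAut {Ω : Set V} {g : (V →L[ℝ] V)ˣ} (hg : g ∈ coneAut Ω) :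
    Set.MapsTo (g : V →L[ℝ] V) (closure Ω) (closure Ω) := by
  refine Set.MapsTo.closure ?_ (g : V →L[ℝ] V).continuous
  intro x hx
  have h : (g : V →L[ℝ] V) '' Ω = Ω := hg
  rw [← h]
  exact ⟨x, hx, rfl⟩

variable [FiniteDimensional ℝ V]

theorem expUnit_mem_coneAut_of_mapsTo {Ω : Set V} (ho : IsOpen Ω) (hc : Convex ℝ Ω)
    {X : V →L[ℝ] V}
    (h : ∀ t : ℝ, Set.MapsTo (NormedSpace.exp (t • X) : V →L[ℝ] V) (closure Ω) (closure Ω)) (t : ℝ) :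
    expUnit (t • X) ∈ coneAut Ω := by
  have key : ∀ t : ℝ, (expUnit (t • X) : V →L[ℝ] V) '' Ω ⊆ Ω := by
    intro t
    conv_rhs => rw [← interior_closure_eq ho hc]
    refine interior_maximal ?_ ?_
    · rintro _ ⟨x, hx, rfl⟩
      exact h t (subset_closure hx)
    · exact (ContinuousLinearEquiv.ofUnit (expUnit (t • X))).toHomeomorph.isOpenMap _ ho
  refine Set.Subset.antisymm (key t) fun x hx => ?_
  refine ⟨NormedSpace.exp (-(t • X)) x, ?_, ?_⟩
  · have := key (-t) ⟨x, hx, rfl⟩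
    simpa [expUnit] using this
  · have := congrArg (fun A : V →L[ℝ] V => A x) (exp_mul_exp_neg (t • X))
    simpa [expUnit] using this

theorem mapsTo_exp_add {Ω : Set V} {X Y : V →L[ℝ] V}
    (hX : ∀ t : ℝ, expUnit (t • X) ∈ coneAut Ω) (hY : ∀ t : ℝ, expUnit (t • Y) ∈ coneAut Ω)
    (t : ℝ) : Set.MapsTo (NormedSpace.exp (t • (X + Y)) : V →L[ℝ] V) (closure Ω) (closure Ω) := by
  intro x hx
  rw [smul_add]
  have hl := tendsto_exp_mul_exp_pow (t • X) (t • Y)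
  have hl' := ((ContinuousLinearMap.apply ℝ V x).continuous.tendsto _).comp hl
  refine isClosed_closure.mem_of_tendsto hl' (Filter.Eventually.of_forall fun n => ?_)
  have h1 : expUnit ((n : ℝ)⁻¹ • t • X) ∈ coneAut Ω := by rw [smul_smul]; exact hX _
  have h2 : expUnit ((n : ℝ)⁻¹ • t • Y) ∈ coneAut Ω := by rw [smul_smul]; exact hY _
  exact mapsTo_closure_of_mem_coneAut ((coneAut Ω).pow_mem ((coneAut Ω).mul_mem h1 h2) n) hx

theorem expUnit_conj (g : (V →L[ℝ] V)ˣ) (X : V →L[ℝ] V) :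
    expUnit ((g : V →L[ℝ] V) * X * ((g⁻¹ : (V →L[ℝ] V)ˣ) : V →L[ℝ] V)) =
      g * expUnit X * g⁻¹ := by
  let +nondep : NormedAlgebra ℚ (V →L[ℝ] V) := .restrictScalars ℚ ℝ _
  ext1
  simpa [expUnit] using NormedSpace.exp_units_conj g X

/-- The infinitesimal automorphisms of an open convex set form a subspace. -/
def coneLieSubmodule {Ω : Set V} (ho : IsOpen Ω) (hc : Convex ℝ Ω) :
    Submodule ℝ (V →L[ℝ] V) where
  carrier := {X | ∀ t : ℝ, expUnit (t • X) ∈ coneAut Ω}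
  zero_mem' := by
    intro t
    have : expUnit (t • (0 : V →L[ℝ] V)) = 1 := by ext1; simp [expUnit]
    rw [this]; exact one_mem _
  add_mem' := fun hX hY t => expUnit_mem_coneAut_of_mapsTo ho hc (mapsTo_exp_add hX hY) t
  smul_mem' := fun c X hX t => by rw [smul_smul]; exact hX _

theorem lie_mem_coneLieSubmodule {Ω : Set V} (ho : IsOpen Ω) (hc : Convex ℝ Ω)
    {X Y : V →L[ℝ] V} (hX : X ∈ coneLieSubmodule ho hc) (hY : Y ∈ coneLieSubmodule ho hc) :
    ⁅X, Y⁆ ∈ coneLieSubmodule ho hc := by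
  let +nondep : NormedAlgebra ℚ (V →L[ℝ] V) := .restrictScalars ℚ ℝ _
  set f : ℝ → (V →L[ℝ] V) := fun t =>
    NormedSpace.exp (t • X) * Y * NormedSpace.exp (t • (-X)) with hf
  have hmem : ∀ t, f t ∈ coneLieSubmodule ho hc := by
    intro t s
    have e : s • f t = ((expUnit (t • X) : (V →L[ℝ] V)ˣ) : V →L[ℝ] V) * (s • Y) *
        (((expUnit (t • X))⁻¹ : (V →L[ℝ] V)ˣ) : V →L[ℝ] V) := by
      change s • (NormedSpace.exp (t • X) * Y * NormedSpace.exp (t • (-X))) =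
        NormedSpace.exp (t • X) * (s • Y) * NormedSpace.exp (-(t • X))
      rw [smul_neg]; simp
    rw [e, expUnit_conj]
    exact mul_mem (mul_mem (hX t) (hY s)) (inv_mem (hX t))
  have hd : HasDerivAt f ⁅X, Y⁆ 0 := by
    have h1 := hasDerivAt_exp_smul_const (𝕂 := ℝ) X (0 : ℝ)
    have h2 := hasDerivAt_exp_smul_const (𝕂 := ℝ) (-X) (0 : ℝ)
    have h := (h1.mul_const Y).mul h2
    have e : NormedSpace.exp ((0 : ℝ) • X) * X * Y * NormedSpace.exp ((0 : ℝ) • (-X)) +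
        NormedSpace.exp ((0 : ℝ) • X) * Y * (NormedSpace.exp ((0 : ℝ) • (-X)) * (-X)) =
        ⁅X, Y⁆ := by simp [LieRing.of_associative_ring_bracket, sub_eq_add_neg]
    rw [e] at h
    exact h
  have hcl : IsClosed (coneLieSubmodule ho hc : Set (V →L[ℝ] V)) :=
    Submodule.closed_of_finiteDimensional _
  refine hcl.mem_of_tendsto hd.tendsto_slope_zero (Filter.Eventually.of_forall fun t => ?_)
  exact Submodule.smul_mem _ _ (Submodule.sub_mem _ (hmem _) (hmem _))

namespace SymmetricCone

/-- The Lie algebra `{X | exp (t X) ∈ G(Ω) for all real t}` of the closed subgroup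
`G(Ω) ⊆ GL(V)`, and of its identity component, with the commutator bracket. -/
def lieAlg (Ω : SymmetricCone V) : LieSubalgebra ℝ (V →L[ℝ] V) where
  __ := coneLieSubmodule Ω.isOpen Ω.convex
  lie_mem' := fun hX hY => lie_mem_coneLieSubmodule Ω.isOpen Ω.convex hX hY

/-- The joint eigenspace `{X ∈ 𝔤(Ω) | [A, X] = α(A) X for all A ∈ 𝔞}`. -/
def rootSpace (Ω : SymmetricCone V) (𝔞 : Submodule ℝ (V →L[ℝ] V)) (α : 𝔞 →ₗ[ℝ] ℝ) :
    Submodule ℝ (V →L[ℝ] V) where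
  carrier := {X | X ∈ Ω.lieAlg ∧ ∀ A : 𝔞, ⁅(A : V →L[ℝ] V), X⁆ = α A • X}
  zero_mem' := ⟨zero_mem _, by simp⟩
  add_mem' := fun hX hY => ⟨add_mem hX.1 hY.1, fun A => by rw [lie_add, hX.2, hY.2, smul_add]⟩
  smul_mem' := fun c X hX =>
    ⟨Ω.lieAlg.smul_mem c hX.1, fun A => by rw [lie_smul, hX.2, smul_comm]⟩

end SymmetricCone

/-- The data on which an Iwasawa decomposition `G₀(Ω) = K A N` with `K = G₀(Ω) ∩ O(V)` depends.
The Cartan involution fixing `K` is `X ↦ -X*`, so that its `-1` eigenspace consists of the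
self-adjoint elements of `𝔤(Ω)`. The data are a maximal abelian subspace `𝔞` of that eigenspace,
and a regular element of `𝔞`, which singles out a system of positive roots. -/
structure IwasawaDatum (Ω : SymmetricCone V) where
  𝔞 : Submodule ℝ (V →L[ℝ] V)
  mem_lieAlg : ∀ A ∈ 𝔞, A ∈ Ω.lieAlg
  selfAdjoint : ∀ A ∈ 𝔞, ∀ x y : V, inner ℝ (A x) y = inner ℝ x (A y)
  abelian : ∀ A ∈ 𝔞, ∀ B ∈ 𝔞, ⁅A, B⁆ = 0
  maximal : ∀ B ∈ Ω.lieAlg, (∀ x y : V, inner ℝ (B x) y = inner ℝ x (B y)) →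
    (∀ A ∈ 𝔞, ⁅A, B⁆ = 0) → B ∈ 𝔞
  A₀ : 𝔞
  regular : ∀ α : 𝔞 →ₗ[ℝ] ℝ, α ≠ 0 → Ω.rootSpace 𝔞 α ≠ ⊥ → α A₀ ≠ 0

namespace IwasawaDatum

variable {Ω : SymmetricCone V} (I : IwasawaDatum Ω)

/-- The sum `𝔫` of the root spaces of the positive roots. -/
def 𝔫 : Submodule ℝ (V →L[ℝ] V) :=
  ⨆ α : {α : I.𝔞 →ₗ[ℝ] ℝ // 0 < α I.A₀}, Ω.rootSpace I.𝔞 α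

theorem 𝔫_le : I.𝔫 ≤ Ω.lieAlg.toSubmodule :=
  iSup_le fun _ _ hX => hX.1

theorem lie_𝔞_𝔫 {A X : V →L[ℝ] V} (hA : A ∈ I.𝔞) (hX : X ∈ I.𝔫) : ⁅A, X⁆ ∈ I.𝔫 := by
  refine Submodule.iSup_induction _ (motive := fun X => ⁅A, X⁆ ∈ I.𝔫) hX ?_ (by simp) ?_
  · intro α X hX
    rw [hX.2 ⟨A, hA⟩]
    exact I.𝔫.smul_mem _ (Submodule.mem_iSup_of_mem α hX)
  · intro X Y h1 h2
    rw [lie_add]; exact add_mem h1 h2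

theorem lie_𝔫_𝔫 {X Y : V →L[ℝ] V} (hX : X ∈ I.𝔫) (hY : Y ∈ I.𝔫) : ⁅X, Y⁆ ∈ I.𝔫 := by
  refine Submodule.iSup_induction _ (motive := fun X => ⁅X, Y⁆ ∈ I.𝔫) hX ?_ (by simp) ?_
  · intro α X hX
    refine Submodule.iSup_induction _ (motive := fun Y => ⁅X, Y⁆ ∈ I.𝔫) hY ?_ (by simp) ?_
    · intro β Y hY
      refine Submodule.mem_iSup_of_mem
        (⟨α.1 + β.1, by simpa using add_pos α.2 β.2⟩ : {α : I.𝔞 →ₗ[ℝ] ℝ // 0 < α I.A₀}) ?_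
      refine ⟨Ω.lieAlg.lie_mem hX.1 hY.1, fun A => ?_⟩
      rw [leibniz_lie, hX.2 A, hY.2 A, smul_lie, lie_smul, ← add_smul]
      rfl
    · intro Y Z h1 h2
      rw [lie_add]; exact add_mem h1 h2
  · intro Y Z h1 h2
    rw [add_lie]; exact add_mem h1 h2

/-- The solvable Lie algebra `𝔥 = 𝔞 + 𝔫`. -/
def 𝔥 : LieSubalgebra ℝ (V →L[ℝ] V) where
  __ := I.𝔞 ⊔ I.𝔫
  lie_mem' := by
    intro X₁ Y₁ hX₁ hY₁
    obtain ⟨A, hA, X, hX, rfl⟩ := Submodule.mem_sup.1 hX₁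
    obtain ⟨B, hB, Y, hY, rfl⟩ := Submodule.mem_sup.1 hY₁
    refine Submodule.mem_sup_right (S := I.𝔞) ?_
    rw [add_lie, lie_add, lie_add, I.abelian A hA B hB, zero_add, ← lie_skew X B]
    exact add_mem (I.lie_𝔞_𝔫 hA hY)
      (add_mem (neg_mem (I.lie_𝔞_𝔫 hB hX)) (I.lie_𝔫_𝔫 hX hY))

theorem 𝔥_le : I.𝔥 ≤ Ω.lieAlg := by
  intro X₁ hX₁
  obtain ⟨A, hA, X, hX, rfl⟩ := Submodule.mem_sup.1 hX₁
  exact add_mem (I.mem_lieAlg A hA) (I.𝔫_le hX)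

/-- The group `H = A N`. In the Iwasawa decomposition `A`, `N` and `A N` are the connected Lie
subgroups of `G₀(Ω)` with Lie algebras `𝔞`, `𝔫` and `𝔥 = 𝔞 + 𝔫`; the connected Lie subgroup with a
given Lie algebra is the subgroup of `GL(V)` generated by its exponentials. -/
def H : Subgroup (V →L[ℝ] V)ˣ :=
  Subgroup.closure {g | ∃ Y ∈ I.𝔥, expUnit Y = g}

theorem H_le : I.H ≤ coneAut Ω.carrier := by
  refine (Subgroup.closure_le _).2 ?_
  rintro _ ⟨Y, hY, rfl⟩
  have h : ∀ t : ℝ, expUnit (t • Y) ∈ coneAut Ω.carrier := I.𝔥_le hY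
  simpa using h 1

theorem det_pos {h : (V →L[ℝ] V)ˣ} (hh : h ∈ I.H) : 0 < (h : V →L[ℝ] V).det := by
  refine Subgroup.closure_induction (p := fun (h : (V →L[ℝ] V)ˣ) _ => 0 < (h : V →L[ℝ] V).det) ?_ ?_ ?_ ?_ hh
  · rintro _ ⟨Y, -, rfl⟩
    have e : (expUnit Y : V →L[ℝ] V) =
        NormedSpace.exp ((1 / 2 : ℝ) • Y) * NormedSpace.exp ((1 / 2 : ℝ) • Y) := by
      rw [← exp_add_smul]; norm_num [expUnit]
    have hu : (NormedSpace.exp ((1 / 2 : ℝ) • Y)).det ≠ 0 := by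
      intro h0
      have h1 := congrArg ContinuousLinearMap.det (exp_mul_exp_neg ((1 / 2 : ℝ) • Y))
      simp [ContinuousLinearMap.det, ContinuousLinearMap.toLinearMap_mul] at h0 h1
      rw [h0] at h1
      simp at h1
    rw [e, ContinuousLinearMap.det, ContinuousLinearMap.toLinearMap_mul, map_mul]
    exact mul_self_pos.2 hu
  · simp [ContinuousLinearMap.det, ContinuousLinearMap.toLinearMap_one]
  · intro a b _ _ ha hb
    rw [Units.val_mul, ContinuousLinearMap.det, ContinuousLinearMap.toLinearMap_mul, map_mul]
    exact mul_pos ha hb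
  · intro a _ ha
    have h1 := congrArg ContinuousLinearMap.det a.inv_mul
    rw [ContinuousLinearMap.det, ContinuousLinearMap.toLinearMap_mul, map_mul] at h1
    have h2 : (((a⁻¹ : (V →L[ℝ] V)ˣ) : V →L[ℝ] V)).det * (a : V →L[ℝ] V).det = 1 := by
      refine h1.trans ?_
      simp [ContinuousLinearMap.det, ContinuousLinearMap.toLinearMap_one]
    exact pos_of_mul_pos_left (by rw [h2]; exact one_pos) ha.le

/-- The natural action of `H` on the additive group `V`. -/
def act : I.H →* MulAut (Multiplicative V) where
  toFun h :=
    { toFun := fun x => Multiplicative.ofAdd ((h.1 : V →L[ℝ] V) x.toAdd)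
      invFun := fun x => Multiplicative.ofAdd (((h.1⁻¹ : (V →L[ℝ] V)ˣ) : V →L[ℝ] V) x.toAdd)
      left_inv := fun x => by
        have e := congrArg (fun A : V →L[ℝ] V => A x.toAdd) h.1.inv_mul
        exact congrArg Multiplicative.ofAdd e
      right_inv := fun x => by
        have e := congrArg (fun A : V →L[ℝ] V => A x.toAdd) h.1.mul_inv
        exact congrArg Multiplicative.ofAdd e
      map_mul' := fun x y => by simp }
  map_one' := by ext x; rfl
  map_mul' _ _ := by ext x; rfl

/-- The group `𝒢 = H ⋉ V`, with `(h, x) (h₁, x₁) = (h h₁, h x₁ + x)`. -/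
abbrev G : Type _ := Multiplicative V ⋊[I.act] I.H

/-- The element `(h, x)` of `𝒢`. -/
def mkG (h : I.H) (x : V) : I.G := ⟨Multiplicative.ofAdd x, h⟩

theorem mkG_mul (h h₁ : I.H) (x x₁ : V) :
    I.mkG h x * I.mkG h₁ x₁ = I.mkG (h * h₁) ((h.1 : V →L[ℝ] V) x₁ + x) := by
  ext
  · exact add_comm x _
  · rfl

/-- The Lie algebra `𝔤 = 𝔥 ⋉ V` of `𝒢`, with
`[(Y, v), (Y', v')] = ([Y, Y'], Y v' - Y' v)`. -/
def 𝔤 : Type _ := I.𝔥 × V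

noncomputable instance : NormedAddCommGroup I.𝔤 := inferInstanceAs (NormedAddCommGroup (I.𝔥 × V))
noncomputable instance : NormedSpace ℝ I.𝔤 := inferInstanceAs (NormedSpace ℝ (I.𝔥 × V))

instance : Bracket I.𝔤 I.𝔤 where
  bracket X X' := (⁅X.1, X'.1⁆, X.1.1 X'.2 - X'.1.1 X.2)

theorem bracket_def (X X' : I.𝔤) : ⁅X, X'⁆ = (⁅X.1, X'.1⁆, X.1.1 X'.2 - X'.1.1 X.2) := rfl

noncomputable instance : LieRing I.𝔤 where
  add_lie X Y Z := by
    refine Prod.ext (add_lie X.1 Y.1 Z.1) ?_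
    change (X.1.1 + Y.1.1) Z.2 - Z.1.1 (X.2 + Y.2) =
      (X.1.1 Z.2 - Z.1.1 X.2) + (Y.1.1 Z.2 - Z.1.1 Y.2)
    rw [map_add, add_apply]; abel
  lie_add X Y Z := by
    refine Prod.ext (lie_add X.1 Y.1 Z.1) ?_
    change X.1.1 (Y.2 + Z.2) - (Y.1.1 + Z.1.1) X.2 =
      (X.1.1 Y.2 - Y.1.1 X.2) + (X.1.1 Z.2 - Z.1.1 X.2)
    rw [map_add, add_apply]; abel
  lie_self X := Prod.ext (lie_self X.1) (sub_self _)
  leibniz_lie X Y Z := by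
    refine Prod.ext (leibniz_lie X.1 Y.1 Z.1) ?_
    change X.1.1 (Y.1.1 Z.2 - Z.1.1 Y.2) - (Y.1.1 * Z.1.1 - Z.1.1 * Y.1.1) X.2 =
      ((X.1.1 * Y.1.1 - Y.1.1 * X.1.1) Z.2 - Z.1.1 (X.1.1 Y.2 - Y.1.1 X.2)) +
      (Y.1.1 (X.1.1 Z.2 - Z.1.1 X.2) - (X.1.1 * Z.1.1 - Z.1.1 * X.1.1) Y.2)
    simp only [map_sub, sub_apply, mul_apply_eq_comp]
    abel

noncomputable instance : LieAlgebra ℝ I.𝔤 where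
  lie_smul t X Y := by
    refine Prod.ext (lie_smul t X.1 Y.1) ?_
    change X.1.1 (t • Y.2) - (t • Y.1.1) X.2 = t • (X.1.1 Y.2 - Y.1.1 X.2)
    rw [map_smul, smul_apply, smul_sub]

/-- The exponential map `𝔤 → 𝒢`, `exp (Y, v) = (exp Y, ∫₀¹ exp (s Y) v ds)`. -/
noncomputable def expG (X : I.𝔤) : I.G :=
  I.mkG ⟨expUnit X.1.1, Subgroup.subset_closure ⟨X.1.1, X.1.2, rfl⟩⟩
    (∫ s in (0 : ℝ)..1, NormedSpace.exp (s • X.1.1) X.2)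

/-- `t ↦ exp (t X)` is a one-parameter subgroup. -/
theorem expG_add_smul (X : I.𝔤) (a b : ℝ) :
    I.expG ((a + b) • X) = I.expG (a • X) * I.expG (b • X) := by
  have hF : ∀ r : ℝ, (∫ s in (0 : ℝ)..1, NormedSpace.exp (s • (r • X).1.1) (r • X).2) =
      ∫ u in (0 : ℝ)..r, NormedSpace.exp (u • X.1.1) X.2 := by
    intro r
    have h := intervalIntegral.smul_integral_comp_mul_right (a := 0) (b := 1)
      (fun u : ℝ => NormedSpace.exp (u • X.1.1) X.2) r
    rw [zero_mul, one_mul] at h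
    rw [← h, ← intervalIntegral.integral_smul]
    refine intervalIntegral.integral_congr fun s _ => ?_
    change NormedSpace.exp (s • r • X.1.1) (r • X.2) = r • NormedSpace.exp ((s * r) • X.1.1) X.2
    rw [map_smul, smul_smul]
  have hc : Continuous fun u : ℝ => NormedSpace.exp (u • X.1.1) X.2 :=
    continuous_exp_smul_apply X.1.1 X.2
  rw [expG, expG, expG, mkG_mul, hF, hF, hF]
  ext
  · change (∫ u in (0 : ℝ)..(a + b), NormedSpace.exp (u • X.1.1) X.2) =
      NormedSpace.exp (a • X.1.1) (∫ u in (0 : ℝ)..b, NormedSpace.exp (u • X.1.1) X.2) +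
        ∫ u in (0 : ℝ)..a, NormedSpace.exp (u • X.1.1) X.2
    rw [← ContinuousLinearMap.intervalIntegral_comp_comm _ (hc.intervalIntegrable _ _), add_comm,
      ← intervalIntegral.integral_add_adjacent_intervals (hc.intervalIntegrable 0 a)
        (hc.intervalIntegrable a (b + a))]
    rw [add_comm]
    congr 1
    have h := intervalIntegral.integral_comp_add_left (a := 0) (b := b)
      (fun u : ℝ => NormedSpace.exp (u • X.1.1) X.2) a
    rw [add_zero] at h
    rw [add_comm b a, ← h]
    refine intervalIntegral.integral_congr fun s _ => ?_
    rw [exp_add_smul]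
    rfl
  · exact congrArg (fun A : V →L[ℝ] V => A _) (exp_add_smul X.1.1 a b)


/-- The coordinates `(Y, v) ↦ g · (exp Y, v)` of `𝒢` around `g`. The map is smooth on all of `𝔤` and
restricts to a diffeomorphism from a neighbourhood of `0` onto a neighbourhood of `g`: on the
`H` factor it is the exponential chart `Y ↦ h exp Y` of a Lie group, on `V` it is affine. -/
noncomputable def chart (g : I.G) (X : I.𝔤) : I.G :=
  g * I.mkG ⟨expUnit X.1.1, Subgroup.subset_closure ⟨X.1.1, X.1.2, rfl⟩⟩ X.2

end IwasawaDatum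
end Cone

section Smooth

/-- `f` has derivative `f'` at the point `0` of the real line, for values in a topological vector
space. -/
def HasDerivAtZero {F : Type*} [AddCommGroup F] [Module ℝ F] [TopologicalSpace F]
    (f : ℝ → F) (f' : F) : Prop :=
  Filter.Tendsto (fun t : ℝ => t⁻¹ • (f t - f 0)) (𝓝[≠] 0) (𝓝 f')

/-- Smoothness of a map from a finite-dimensional space to a topological vector space: all iterated
directional derivatives `D k x (v₁, …, v_k)` exist and are jointly continuous in the point `x` and
the directions `v₁, …, v_k`. -/
def IsSmoothMap {E F : Type*} [NormedAddCommGroup E] [NormedSpace ℝ E]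
    [AddCommGroup F] [Module ℝ F] [TopologicalSpace F] (f : E → F) : Prop :=
  ∃ D : (k : ℕ) → E → (Fin k → E) → F,
    (∀ x v, D 0 x v = f x) ∧
    (∀ k x v w, HasDerivAtZero (fun t : ℝ => D k (x + t • w) v) (D (k + 1) x (Fin.cons w v))) ∧
    ∀ k, Continuous fun p : E × (Fin k → E) => D k p.1 p.2

end Smooth

section Representation

variable {V : Type*} [NormedAddCommGroup V] [InnerProductSpace ℝ V] [FiniteDimensional ℝ V]
  [MeasurableSpace V] [BorelSpace V]

/-- The Fourier transform `(2π)^(-n/2) ∫ f(x) e^{-i⟨x, w⟩} dx`, where `n = dim V`. -/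
noncomputable def fourierV (f : V → ℂ) (w : V) : ℂ :=
  (((2 * Real.pi) ^ (-(Module.finrank ℝ V : ℝ) / 2) : ℝ) : ℂ) *
    ∫ x : V, f x * Complex.exp (-(Complex.I * (inner ℝ x w : ℝ)))

theorem integrable_fourierV (f : 𝓢(V, ℂ)) (w : V) :
    MeasureTheory.Integrable (fun x : V => f x * Complex.exp (-(Complex.I * (inner ℝ x w : ℝ)))) := by
  refine f.integrable.mul_bdd (c := 1) ?_ (Filter.Eventually.of_forall fun x => ?_)
  · exact (by fun_prop : Continuous fun x : V =>
      Complex.exp (-(Complex.I * (inner ℝ x w : ℝ)))).aestronglyMeasurable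
  · rw [Complex.norm_exp]; simp

/-- The space `𝒮_Ω` of Schwartz functions whose Fourier transform vanishes outside `Ω`; it carries
the subspace topology. -/
noncomputable def SchwartzCone (Ω : SymmetricCone V) : Submodule ℂ 𝓢(V, ℂ) where
  carrier := {f | ∀ w, w ∉ Ω.carrier → fourierV f w = 0}
  zero_mem' := by intro w _; simp [fourierV]
  add_mem' := by
    intro f g hf hg w hw
    have hf := hf w hw
    have hg := hg w hw
    simp only [fourierV, add_apply, add_mul] at hf hg ⊢
    rw [MeasureTheory.integral_add (integrable_fourierV f w) (integrable_fourierV g w), mul_add,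
      hf, hg, add_zero]
  smul_mem' := by
    intro c f hf w hw
    have hf := hf w hw
    simp only [fourierV, smul_apply, smul_eq_mul, mul_assoc,
      MeasureTheory.integral_const_mul] at hf ⊢
    rw [mul_left_comm, hf, mul_zero]

/-- The operator `f ↦ det(h)^{-1/2} f(h⁻¹(· - x))` on Schwartz functions. -/
noncomputable def quasiRegular (h : (V →L[ℝ] V)ˣ) (x : V) : 𝓢(V, ℂ) →L[ℂ] 𝓢(V, ℂ) :=
  (((1 / √(h : V →L[ℝ] V).det : ℝ)) : ℂ) •
    (SchwartzMap.compSubConstCLM ℂ x).comp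
      (SchwartzMap.compCLMOfContinuousLinearEquiv ℂ (ContinuousLinearEquiv.ofUnit h⁻¹))

theorem quasiRegular_apply (h : (V →L[ℝ] V)ˣ) (x : V) (f : 𝓢(V, ℂ)) (t : V) :
    quasiRegular h x f t = ((1 / √(h : V →L[ℝ] V).det : ℝ) : ℂ) *
      f (((h⁻¹ : (V →L[ℝ] V)ˣ) : V →L[ℝ] V) (t - x)) := rfl

theorem adjoint_notMem {Ω : SymmetricCone V} {h : (V →L[ℝ] V)ˣ} (hh : h ∈ coneAut Ω.carrier)
    {w : V} (hw : w ∉ Ω.carrier) :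
    ContinuousLinearMap.adjoint (h : V →L[ℝ] V) w ∉ Ω.carrier := by
  intro hm
  apply hw
  rw [Ω.self_dual] at hm ⊢
  intro x hx hx0
  have hinv := inv_mem hh
  have h1 : (((h⁻¹ : (V →L[ℝ] V)ˣ) : V →L[ℝ] V)) x ∈ closure Ω.carrier :=
    mapsTo_closure_of_mem_coneAut hinv hx
  have h2 : (h : V →L[ℝ] V) (((h⁻¹ : (V →L[ℝ] V)ˣ) : V →L[ℝ] V) x) = x :=
    congrArg (fun A : V →L[ℝ] V => A x) h.mul_inv
  have h3 : (((h⁻¹ : (V →L[ℝ] V)ˣ) : V →L[ℝ] V)) x ≠ 0 := by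
    intro h0
    rw [h0, map_zero] at h2
    exact hx0 h2.symm
  have h4 := hm _ h1 h3
  rwa [ContinuousLinearMap.adjoint_inner_right, h2] at h4

/-- `π(h, x) f` has Fourier transform a multiple of `w ↦ e^{-i⟨x, w⟩} f̂(h* w)`. -/
theorem fourierV_quasiRegular (h : (V →L[ℝ] V)ˣ) (x : V) (f : 𝓢(V, ℂ)) (w : V) :
    fourierV (quasiRegular h x f) w =
      ((1 / √(h : V →L[ℝ] V).det : ℝ) : ℂ) * ((|(h : V →L[ℝ] V).det| : ℝ) : ℂ) *
        Complex.exp (-(Complex.I * (inner ℝ x w : ℝ))) *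
        fourierV f (ContinuousLinearMap.adjoint (h : V →L[ℝ] V) w) := by
  have hinv : ∀ y, (((h⁻¹ : (V →L[ℝ] V)ˣ) : V →L[ℝ] V)) ((h : V →L[ℝ] V) y) = y := fun y =>
    congrArg (fun A : V →L[ℝ] V => A y) h.inv_mul
  have hcv := MeasureTheory.integral_image_eq_integral_abs_det_fderiv_smul
    (MeasureTheory.volume : MeasureTheory.Measure V) (s := Set.univ) MeasurableSet.univ
    (f := fun y => (h : V →L[ℝ] V) y + x) (f' := fun _ => (h : V →L[ℝ] V))
    (fun y _ => ((h : V →L[ℝ] V).hasFDerivAt.add_const x).hasFDerivWithinAt)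
    (by
      intro a _ b _ hab
      have := congrArg (fun z => (((h⁻¹ : (V →L[ℝ] V)ˣ) : V →L[ℝ] V)) z)
        (add_right_cancel hab)
      simpa [hinv] using this)
    (fun t => quasiRegular h x f t * Complex.exp (-(Complex.I * (inner ℝ t w : ℝ))))
  have himg : (fun y => (h : V →L[ℝ] V) y + x) '' Set.univ = Set.univ := by
    rw [Set.image_univ, Set.range_eq_univ]
    intro z
    refine ⟨(((h⁻¹ : (V →L[ℝ] V)ˣ) : V →L[ℝ] V)) (z - x), ?_⟩
    have h2 : (h : V →L[ℝ] V) (((h⁻¹ : (V →L[ℝ] V)ˣ) : V →L[ℝ] V) (z - x)) = z - x :=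
      congrArg (fun A : V →L[ℝ] V => A (z - x)) h.mul_inv
    change (h : V →L[ℝ] V) _ + x = z
    rw [h2, sub_add_cancel]
  rw [himg, MeasureTheory.setIntegral_univ, MeasureTheory.setIntegral_univ] at hcv
  unfold fourierV
  rw [hcv]
  have hpt : ∀ y : V, |(h : V →L[ℝ] V).det| • (quasiRegular h x f ((h : V →L[ℝ] V) y + x) *
      Complex.exp (-(Complex.I * (inner ℝ ((h : V →L[ℝ] V) y + x) w : ℝ)))) =
      (((1 / √(h : V →L[ℝ] V).det : ℝ) : ℂ) * ((|(h : V →L[ℝ] V).det| : ℝ) : ℂ) *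
        Complex.exp (-(Complex.I * (inner ℝ x w : ℝ)))) *
      (f y * Complex.exp (-(Complex.I *
        (inner ℝ y (ContinuousLinearMap.adjoint (h : V →L[ℝ] V) w) : ℝ)))) := by
    intro y
    rw [quasiRegular_apply, add_sub_cancel_right, hinv, ContinuousLinearMap.adjoint_inner_right,
      inner_add_left, Complex.real_smul, Complex.ofReal_add, mul_add, neg_add, Complex.exp_add]
    ring
  simp_rw [hpt]
  rw [MeasureTheory.integral_const_mul]
  ring

theorem quasiRegular_mem {Ω : SymmetricCone V} {h : (V →L[ℝ] V)ˣ} (hh : h ∈ coneAut Ω.carrier)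
    (x : V) {f : 𝓢(V, ℂ)} (hf : f ∈ SchwartzCone Ω) : quasiRegular h x f ∈ SchwartzCone Ω := by
  intro w hw
  rw [fourierV_quasiRegular, hf _ (adjoint_notMem hh hw), mul_zero]

namespace IwasawaDatum

variable {Ω : SymmetricCone V} (I : IwasawaDatum Ω)

/-- The quasi-regular representation `π(h, x) f(t) = det(h)^{-1/2} f(h⁻¹(t - x))` of `𝒢` on
`𝒮_Ω`. -/
noncomputable def rep : I.G →* (SchwartzCone Ω →L[ℂ] SchwartzCone Ω) where
  toFun g := (quasiRegular g.right.1 g.left.toAdd).restrict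
    (fun _ hf => quasiRegular_mem (I.H_le g.right.2) _ hf)
  map_one' := by
    ext f t
    change quasiRegular 1 0 f.1 t = f.1 t
    rw [quasiRegular_apply]
    simp [ContinuousLinearMap.det, ContinuousLinearMap.toLinearMap_one]
  map_mul' a b := by
    ext f t
    change quasiRegular (a.right.1 * b.right.1)
        (a.left.toAdd + (a.right.1 : V →L[ℝ] V) b.left.toAdd) f.1 t =
      quasiRegular a.right.1 a.left.toAdd (quasiRegular b.right.1 b.left.toAdd f.1) t
    have hdet : ((a.right.1 * b.right.1 : (V →L[ℝ] V)ˣ) : V →L[ℝ] V).det =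
        (a.right.1 : V →L[ℝ] V).det * (b.right.1 : V →L[ℝ] V).det := by
      rw [Units.val_mul, ContinuousLinearMap.det, ContinuousLinearMap.toLinearMap_mul, map_mul]
    have hinv : (((a.right.1)⁻¹ : (V →L[ℝ] V)ˣ) : V →L[ℝ] V)
        ((a.right.1 : V →L[ℝ] V) b.left.toAdd) = b.left.toAdd :=
      congrArg (fun A : V →L[ℝ] V => A b.left.toAdd) a.right.1.inv_mul
    rw [quasiRegular_apply, quasiRegular_apply, quasiRegular_apply, hdet,
      Real.sqrt_mul (I.det_pos a.right.2).le, mul_inv_rev, Units.val_mul, mul_apply_eq_comp,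
      ← sub_sub, map_sub _ (t - a.left.toAdd), hinv, ← mul_assoc, ← Complex.ofReal_mul]
    congr 2
    rw [one_div_mul_one_div]

/-- `ψ` is a smooth vector: the orbit map `g ↦ π(g) ψ` is smooth from `𝒢` to `𝒮_Ω`, that is, it is
smooth in the coordinates around every point of `𝒢`. -/
def IsSmoothVector (ψ : SchwartzCone Ω) : Prop :=
  ∀ g : I.G, IsSmoothMap fun X : I.𝔤 => I.rep (I.chart g X) ψ

end IwasawaDatum

end Representation

end SymCone

/-! The group acts by affine substitutions, and substituting into a Schwartz function a family of
invertible affine maps that depends smoothly on parameters is a smooth operation in the Schwartz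
topology.

In the chart around `g`, the orbit map is `π(g)` applied to `π(exp Y, v) ψ`. Since `det (exp Y) =
e^{tr Y}`, the latter is the function `t ↦ e^{-tr Y/2} ψ(e^{-Y} t - e^{-Y} v)`, which is jointly
smooth in `(Y, v)` and `t`. All its derivatives decay rapidly in `t`, locally uniformly in `(Y, v)`:
derivatives of the affine argument grow at most linearly in `t`, and because the map is invertible,
the decay of `ψ` at the image point is decay in `t` (`isSchwartzFamily_comp_affine`).

Locally uniform decay turns pointwise parameter derivatives into derivatives for every Schwartz
seminorm, by the mean value inequality (`IsSchwartzFamily.hasDerivAtZero_slice`). This iterates,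
because parameter derivatives of such a family form such a family again. The derivatives remain in
`𝒮_Ω`, being limits of difference quotients in a closed subspace (`isClosed_schwartzCone`). The
continuous operator `π(g)` then carries smoothness at the identity to `g`.

The same argument along `exp (s X)` gives the derived operator for `X = (Y, v)`: `ψ ↦ -(tr Y/2) ψ -
Dψ(Y t + v)`. Linearity is visible from this formula. The bracket relation follows from symmetry of
the second derivative and `tr [Y, Y'] = 0`. The extension to the enveloping algebra is its universal
property. -/

namespace SymCone

/-! ### Smooth families of Schwartz functions and their parameter derivatives. -/

section SchwartzFamily

open scoped ContDiff
open Filter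

variable {E E' V F G : Type*} [NormedAddCommGroup E] [NormedSpace ℝ E]
  [NormedAddCommGroup E'] [NormedSpace ℝ E'] [NormedAddCommGroup V] [NormedSpace ℝ V]
  [NormedAddCommGroup F] [NormedSpace ℝ F] [NormedAddCommGroup G] [NormedSpace ℝ G]

/-- A smooth function of a parameter in `E` and a variable in `V` all of whose derivatives decay
rapidly in the variable, locally uniformly in the parameter. -/
def IsSchwartzFamily (Φ : E × V → F) : Prop :=
  ContDiff ℝ ∞ Φ ∧ ∀ (x₀ : E) (k n : ℕ), ∃ C, ∀ᶠ x in 𝓝 x₀, ∀ t,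
    ‖t‖ ^ k * ‖iteratedFDeriv ℝ n Φ (x, t)‖ ≤ C

/-- Induction on `n`, each step being symmetry of the second derivative of the `n`-th derivative.
This is what allows a parameter derivative to pass through the derivatives appearing in the Schwartz
seminorms. -/
theorem fderiv_iteratedFDeriv_comm {Φ : E → F} (hΦ : ContDiff ℝ ∞ Φ) (w : E) (n : ℕ) (p : E) :
    iteratedFDeriv ℝ n (fun q => fderiv ℝ Φ q w) p = fderiv ℝ (iteratedFDeriv ℝ n Φ) p w := by
  have hdiff : ∀ (m : ℕ), ContDiff ℝ ∞ (iteratedFDeriv ℝ m Φ) := fun m =>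
    hΦ.iteratedFDeriv_right (by norm_cast)
  induction n generalizing p with
  | zero =>
    ext m
    have h : iteratedFDeriv ℝ 0 Φ = fun q => (continuousMultilinearCurryFin0 ℝ E F).symm (Φ q) :=
      iteratedFDeriv_zero_eq_comp
    have h2 : fderiv ℝ (iteratedFDeriv ℝ 0 Φ) p =
        ((continuousMultilinearCurryFin0 ℝ E F).symm.toContinuousLinearEquiv :
          F →L[ℝ] (E [×0]→L[ℝ] F)).comp (fderiv ℝ Φ p) := by
      rw [h]
      exact (((continuousMultilinearCurryFin0 ℝ E F).symm.toContinuousLinearEquiv :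
          F →L[ℝ] (E [×0]→L[ℝ] F)).hasFDerivAt.comp p (hΦ.differentiable (by simp) p).hasFDerivAt).fderiv
    rw [h2]
    simp
  | succ n ih =>
    ext m
    have hD : Differentiable ℝ (fderiv ℝ (iteratedFDeriv ℝ n Φ)) :=
      ((hdiff n).fderiv_right (m := 1) (by norm_cast)).differentiable (by simp)
    rw [iteratedFDeriv_succ_apply_left, funext ih]
    have hA : ∀ w, HasFDerivAt (fun q => fderiv ℝ (iteratedFDeriv ℝ n Φ) q w)
        ((ContinuousLinearMap.apply ℝ _ w).comp (fderiv ℝ (fderiv ℝ (iteratedFDeriv ℝ n Φ)) p)) p :=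
      fun w => HasFDerivAt.comp (g := ContinuousLinearMap.apply ℝ (E [×n]→L[ℝ] F) w)
        (f := fderiv ℝ (iteratedFDeriv ℝ n Φ)) p (ContinuousLinearMap.hasFDerivAt _)
        (hD p).hasFDerivAt
    have h2 : fderiv ℝ (iteratedFDeriv ℝ (n + 1) Φ) p w m =
        fderiv ℝ (fun q => iteratedFDeriv ℝ (n + 1) Φ q m) p w := by
      have := ((ContinuousMultilinearMap.apply ℝ (fun _ : Fin (n + 1) => E) F m).hasFDerivAt.comp p
        ((hdiff (n + 1)).differentiable (by simp) p).hasFDerivAt).fderiv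
      change _ = fderiv ℝ ((ContinuousMultilinearMap.apply ℝ (fun _ : Fin (n + 1) => E) F m) ∘
        iteratedFDeriv ℝ (n + 1) Φ) p w
      rw [this]; rfl
    -- Splitting off the first direction `m 0` leaves a second derivative of `iteratedFDeriv ℝ n Φ`
    -- in the directions `m 0` and `w`, whose order can be exchanged.
    have h3 : (fun q => iteratedFDeriv ℝ (n + 1) Φ q m) = fun q =>
        (ContinuousMultilinearMap.apply ℝ (fun _ : Fin n => E) F (Fin.tail m))
          (fderiv ℝ (iteratedFDeriv ℝ n Φ) q (m 0)) := by
      funext q; exact iteratedFDeriv_succ_apply_left m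
    have h4 := ((ContinuousMultilinearMap.apply ℝ (fun _ : Fin n => E) F
      (Fin.tail m)).hasFDerivAt.comp p (hA (m 0))).fderiv
    have h5 := congrArg (fun A => A w) h4
    rw [h2, h3, (hA w).fderiv]
    refine Eq.trans ?_ h5.symm
    have hs : IsSymmSndFDerivAt ℝ (iteratedFDeriv ℝ n Φ) p :=
      ((hdiff n).contDiffAt).isSymmSndFDerivAt
        (by simpa using WithTop.coe_le_coe.2 (le_top : (2 : ℕ∞) ≤ ⊤))
    exact congrArg (fun A => A (Fin.tail m)) (hs.eq (m 0) w)

/-- Mean value inequality in the parameter alone, at a fixed `t`. The factor `c` will be the weight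
`‖t‖ ^ k`, so that the bound stays uniform in `t`. -/
theorem norm_sub_le_of_norm_fderiv_le {g : E × V → F} (hg : Differentiable ℝ g) {c C : ℝ}
    (hc : 0 ≤ c) {s : Set E} (hs : Convex ℝ s) {t : V} (hC : ∀ z ∈ s, c * ‖fderiv ℝ g (z, t)‖ ≤ C)
    {x y : E} (hx : x ∈ s) (hy : y ∈ s) : c * ‖g (y, t) - g (x, t)‖ ≤ C * ‖y - x‖ := by
  have hder : ∀ z ∈ s, HasFDerivWithinAt (fun z => c • g (z, t))
      (c • (fderiv ℝ g (z, t)).comp (ContinuousLinearMap.inl ℝ E V)) s z := fun z _ =>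
    ((HasFDerivAt.comp (g := g) (f := fun z => (z, t)) z
      (hg (z, t)).hasFDerivAt (hasFDerivAt_prodMk_left z t)).const_smul c).hasFDerivWithinAt
  have h := hs.norm_image_sub_le_of_norm_hasFDerivWithin_le (C := C) hder (fun z hz => ?_) hx hy
  · rwa [← smul_sub, norm_smul, Real.norm_of_nonneg hc] at h
  · refine le_trans ?_ (hC z hz)
    rw [norm_smul, Real.norm_of_nonneg hc]
    gcongr
    refine (ContinuousLinearMap.opNorm_comp_le _ _).trans ?_
    exact mul_le_of_le_one_right (norm_nonneg _) (ContinuousLinearMap.norm_inl_le_one ℝ E V)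

theorem norm_iteratedFDeriv_comp_clm_le {f : G → F} (hf : ContDiff ℝ ∞ f) (L : E →L[ℝ] G) (n : ℕ)
    (p : E) : ‖iteratedFDeriv ℝ n (fun q => f (L q)) p‖ ≤ ‖iteratedFDeriv ℝ n f (L p)‖ * ‖L‖ ^ n := by
  have h := L.iteratedFDeriv_comp_right hf p (i := n) (by norm_cast; exact le_top)
  change ‖iteratedFDeriv ℝ n (f ∘ L) p‖ ≤ _
  rw [h]
  refine (ContinuousMultilinearMap.norm_compContinuousLinearMap_le _ _).trans ?_
  simp

namespace IsSchwartzFamily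

variable {Φ : E × V → F}

theorem fderiv_right (hΦ : IsSchwartzFamily Φ) : IsSchwartzFamily (fderiv ℝ Φ) := by
  refine ⟨hΦ.1.fderiv_right (by norm_cast), fun x₀ k n => ?_⟩
  simpa only [norm_iteratedFDeriv_fderiv] using hΦ.2 x₀ k (n + 1)

theorem comp_param (hΦ : IsSchwartzFamily Φ) (L : E' →L[ℝ] E) :
    IsSchwartzFamily fun p : E' × V => Φ (L p.1, p.2) := by
  let M : E' × V →L[ℝ] E × V := L.prodMap (ContinuousLinearMap.id ℝ V)
  refine ⟨hΦ.1.comp M.contDiff, fun x₀ k n => ?_⟩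
  obtain ⟨C, hC⟩ := hΦ.2 (L x₀) k n
  refine ⟨C * ‖M‖ ^ n, ?_⟩
  filter_upwards [L.continuous.continuousAt.eventually hC] with x hx t
  refine (mul_le_mul_of_nonneg_left (norm_iteratedFDeriv_comp_clm_le hΦ.1 M n (x, t))
    (by positivity)).trans ?_
  rw [← mul_assoc]
  gcongr
  exact hx t

theorem norm_iteratedFDeriv_param_eventually_le {u : E → G} (hu : ContDiff ℝ ∞ u) (x₀ : E) (n : ℕ) :
    ∃ C, 0 ≤ C ∧ ∀ᶠ x in 𝓝 x₀, ∀ t : V,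
      ‖iteratedFDeriv ℝ n (fun p : E × V => u p.1) (x, t)‖ ≤ C := by
  have hc : ContinuousAt (fun x => ‖iteratedFDeriv ℝ n u x‖) x₀ :=
    ((hu.continuous_iteratedFDeriv (m := n) (by norm_cast; exact le_top)).norm).continuousAt
  refine ⟨(‖iteratedFDeriv ℝ n u x₀‖ + 1) * ‖ContinuousLinearMap.fst ℝ E V‖ ^ n, by positivity, ?_⟩
  filter_upwards [hc.eventually (gt_mem_nhds (lt_add_one _))] with x hx t
  refine (norm_iteratedFDeriv_comp_clm_le hu (ContinuousLinearMap.fst ℝ E V) n (x, t)).trans ?_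
  gcongr
  exact hx.le

/-- Leibniz rule: derivatives of `u` do not involve `t` and are locally bounded, so the whole weight
`‖t‖ ^ k` can be spent on `Ψ`. -/
theorem clm_apply {Ψ : E × V → G →L[ℝ] F} (hΨ : IsSchwartzFamily Ψ) {u : E → G}
    (hu : ContDiff ℝ ∞ u) : IsSchwartzFamily fun p : E × V => Ψ p (u p.1) := by
  have hu' : ContDiff ℝ ∞ fun p : E × V => u p.1 := hu.comp contDiff_fst
  refine ⟨hΨ.1.clm_apply hu', fun x₀ k n => ?_⟩
  choose A hA using fun i => hΨ.2 x₀ k i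
  choose B hB hB' using fun i => norm_iteratedFDeriv_param_eventually_le (V := V) hu x₀ i
  refine ⟨∑ i ∈ Finset.range (n + 1), (n.choose i : ℝ) * A i * B (n - i), ?_⟩
  have h1 : ∀ᶠ x in 𝓝 x₀, ∀ i ∈ Finset.range (n + 1), ∀ t,
      ‖t‖ ^ k * ‖iteratedFDeriv ℝ i Ψ (x, t)‖ ≤ A i :=
    (Filter.eventually_all_finset _).2 fun i _ => hA i
  have h2 : ∀ᶠ x in 𝓝 x₀, ∀ i ∈ Finset.range (n + 1), ∀ t : V,
      ‖iteratedFDeriv ℝ (n - i) (fun p : E × V => u p.1) (x, t)‖ ≤ B (n - i) :=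
    (Filter.eventually_all_finset _).2 fun i _ => hB' (n - i)
  filter_upwards [h1, h2] with x hx1 hx2 t
  refine (mul_le_mul_of_nonneg_left (norm_iteratedFDeriv_clm_apply hΨ.1 hu' (x, t) (n := n)
    (by norm_cast; exact le_top)) (by positivity)).trans ?_
  rw [Finset.mul_sum]
  refine Finset.sum_le_sum fun i hi => ?_
  calc _ = (n.choose i : ℝ) * (‖t‖ ^ k * ‖iteratedFDeriv ℝ i Ψ (x, t)‖) *
        ‖iteratedFDeriv ℝ (n - i) (fun p : E × V => u p.1) (x, t)‖ := by ring
    _ ≤ _ := by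
      have := hx1 i hi t
      have h0 : 0 ≤ A i := le_trans (by positivity) this
      gcongr
      exact hx2 i hi t

theorem iteratedFDeriv_slice (hΦ : ContDiff ℝ ∞ Φ) (n : ℕ) (x : E) (t : V) :
    iteratedFDeriv ℝ n (fun t => Φ (x, t)) t =
      (iteratedFDeriv ℝ n Φ (x, t)).compContinuousLinearMap
        fun _ => ContinuousLinearMap.inr ℝ E V := by
  have e : (fun t => Φ (x, t)) = (fun q => Φ (q + (x, 0))) ∘ ContinuousLinearMap.inr ℝ E V := by
    funext t; simp
  rw [e, ContinuousLinearMap.iteratedFDeriv_comp_right _ (n := ∞)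
    (f := fun q => Φ (q + (x, 0)))
    (hΦ.comp (contDiff_id.add contDiff_const)) _ (by norm_cast; exact le_top),
    iteratedFDeriv_comp_add_right]
  simp

theorem norm_compContinuousLinearMap_inr_le {n : ℕ}
    (A : ContinuousMultilinearMap ℝ (fun _ : Fin n => E × V) F) :
    ‖A.compContinuousLinearMap fun _ => ContinuousLinearMap.inr ℝ E V‖ ≤ ‖A‖ := by
  refine (ContinuousMultilinearMap.norm_compContinuousLinearMap_le _ _).trans ?_
  simp only [Finset.prod_const, Finset.card_univ, Fintype.card_fin]
  exact mul_le_of_le_one_right (norm_nonneg _)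
    (pow_le_one₀ (norm_nonneg _) (ContinuousLinearMap.norm_inr_le_one ℝ E V))

/-- The Schwartz function at a given value of the parameter. -/
def slice (hΦ : IsSchwartzFamily Φ) (x : E) : 𝓢(V, F) where
  toFun t := Φ (x, t)
  smooth' := hΦ.1.comp (contDiff_const.prodMk contDiff_id)
  decay' k n := by
    obtain ⟨C, hC⟩ := hΦ.2 x k n
    refine ⟨C, fun t => le_trans ?_ (hC.self_of_nhds t)⟩
    rw [iteratedFDeriv_slice hΦ.1]
    gcongr
    exact norm_compContinuousLinearMap_inr_le _

@[simp] theorem slice_apply (hΦ : IsSchwartzFamily Φ) (x : E) (t : V) :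
    hΦ.slice x t = Φ (x, t) := rfl

theorem iteratedFDeriv_slice_apply (hΦ : IsSchwartzFamily Φ) (n : ℕ) (x : E) (t : V) :
    iteratedFDeriv ℝ n (hΦ.slice x) t = (iteratedFDeriv ℝ n Φ (x, t)).compContinuousLinearMap
        fun _ => ContinuousLinearMap.inr ℝ E V :=
  iteratedFDeriv_slice hΦ.1 n x t

/-- The bound on derivatives of order `n + 1` is a Lipschitz bound on those of order `n`. That the
constant is independent of `t` is what yields seminorm estimates. -/
theorem exists_lipschitz (hΦ : IsSchwartzFamily Φ) (x₀ : E) (k n : ℕ) :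
    ∃ C, 0 ≤ C ∧ ∃ r > 0, ∀ x ∈ Metric.ball x₀ r, ∀ y ∈ Metric.ball x₀ r, ∀ t : V,
      ‖t‖ ^ k * ‖iteratedFDeriv ℝ n Φ (y, t) - iteratedFDeriv ℝ n Φ (x, t)‖ ≤ C * ‖y - x‖ := by
  obtain ⟨C, hC⟩ := hΦ.2 x₀ k (n + 1)
  obtain ⟨r, hr, hball⟩ := Metric.eventually_nhds_iff_ball.1 hC
  have hC0 : 0 ≤ C := le_trans (by positivity) (hball x₀ (Metric.mem_ball_self hr) 0)
  refine ⟨C, hC0, r, hr, fun x hx y hy t => ?_⟩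
  have hd : Differentiable ℝ (iteratedFDeriv ℝ n Φ) :=
    hΦ.1.differentiable_iteratedFDeriv (by norm_cast; exact WithTop.coe_lt_top n)
  refine norm_sub_le_of_norm_fderiv_le hd (by positivity) (convex_ball x₀ r) (fun z hz => ?_) hx hy
  rw [norm_fderiv_iteratedFDeriv]
  exact hball z hz t

theorem continuous_slice (hΦ : IsSchwartzFamily Φ) : Continuous hΦ.slice := by
  refine continuous_iff_continuousAt.2 fun x₀ => ?_
  refine ((schwartz_withSeminorms ℝ V F).tendsto_nhds _ _).2 fun ⟨k, n⟩ ε hε => ?_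
  obtain ⟨C, hC, r, hr, h⟩ := hΦ.exists_lipschitz x₀ k n
  have hlim : Tendsto (fun x => C * ‖x - x₀‖) (𝓝 x₀) (𝓝 0) := by
    have : Continuous fun x => C * ‖x - x₀‖ := by fun_prop
    simpa using this.tendsto x₀
  filter_upwards [Metric.ball_mem_nhds x₀ hr, hlim.eventually (gt_mem_nhds hε)] with x hx hlt
  refine lt_of_le_of_lt (SchwartzMap.seminorm_le_bound ℝ k n _ (by positivity) fun t => ?_) hlt
  refine le_trans ?_ (h x₀ (Metric.mem_ball_self hr) x hx t)
  have e : iteratedFDeriv ℝ n (⇑(hΦ.slice x - hΦ.slice x₀)) t =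
      (iteratedFDeriv ℝ n Φ (x, t) - iteratedFDeriv ℝ n Φ (x₀, t)).compContinuousLinearMap
        fun _ => ContinuousLinearMap.inr ℝ E V := by
    have := iteratedFDeriv_sub_apply (𝕜 := ℝ) (i := n) (f := hΦ.slice x) (g := hΦ.slice x₀)
      (x := t) ((hΦ.slice x).smooth n).contDiffAt ((hΦ.slice x₀).smooth n).contDiffAt
    change iteratedFDeriv ℝ n (⇑(hΦ.slice x) - ⇑(hΦ.slice x₀)) t = _
    rw [this, iteratedFDeriv_slice_apply, iteratedFDeriv_slice_apply]
    rfl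
  rw [e]
  gcongr
  exact norm_compContinuousLinearMap_inr_le _

/-- First-order Taylor estimate in each seminorm: the error of the difference quotient at `s` is at
most `C * ‖s • w‖`, where `C` is the local Lipschitz constant of the family of derivatives in
direction `w`. -/
theorem hasDerivAtZero_slice (hΦ : IsSchwartzFamily Φ) (x w : E) {T : 𝓢(V, F)}
    (hT : ∀ t, T t = fderiv ℝ Φ (x, t) (w, 0)) :
    HasDerivAtZero (fun s : ℝ => hΦ.slice (x + s • w)) T := by
  have hΦw : IsSchwartzFamily fun p : E × V => fderiv ℝ Φ p (w, 0) :=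
    hΦ.fderiv_right.clm_apply (contDiff_const (c := ((w, 0) : E × V)))
  have hTs : T = hΦw.slice x := by ext t; exact hT t
  rw [hTs]
  refine ((schwartz_withSeminorms ℝ V F).tendsto_nhds _ _).2 fun ⟨k, n⟩ ε hε => ?_
  obtain ⟨C, hC, r, hr, h⟩ := hΦw.exists_lipschitz x k n
  have hlim : Tendsto (fun s : ℝ => C * ‖s • w‖) (𝓝[≠] 0) (𝓝 0) := by
    have : Continuous fun s : ℝ => C * ‖s • w‖ := by fun_prop
    simpa using (this.tendsto 0).mono_left nhdsWithin_le_nhds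
  have hin : ∀ᶠ s : ℝ in 𝓝[≠] 0, ‖s • w‖ < r := by
    have : Continuous fun s : ℝ => ‖s • w‖ := by fun_prop
    have := (this.tendsto 0).mono_left (nhdsWithin_le_nhds (s := {0}ᶜ))
    simp only [zero_smul, norm_zero] at this
    exact this.eventually (gt_mem_nhds hr)
  filter_upwards [hin, hlim.eventually (gt_mem_nhds hε), self_mem_nhdsWithin] with s hs hlt hs0
  have hs0' : s ≠ 0 := hs0
  refine lt_of_le_of_lt (SchwartzMap.seminorm_le_bound ℝ k n _ (by positivity) fun t => ?_) hlt
  have hd : Differentiable ℝ (iteratedFDeriv ℝ n Φ) :=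
    hΦ.1.differentiable_iteratedFDeriv (by norm_cast; exact WithTop.coe_lt_top n)
  set R : ContinuousMultilinearMap ℝ (fun _ : Fin n => E × V) F :=
    iteratedFDeriv ℝ n (fun p : E × V => fderiv ℝ Φ p (w, 0)) (x, t) with hR
  -- With the linear part `u • R` removed, the derivative in `u` is the variation of the
  -- `w`-derivative between `x` and `x + u • w`, which the Lipschitz bound makes small. The mean
  -- value inequality from `0` to `s` then gains the factor `|s|` that cancels `s⁻¹`.
  have hder : ∀ u ∈ Metric.closedBall (0 : ℝ) |s|, HasDerivWithinAt
      (fun u : ℝ => ‖t‖ ^ k • (iteratedFDeriv ℝ n Φ (x + u • w, t) - u • R))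
      (‖t‖ ^ k • (iteratedFDeriv ℝ n (fun p : E × V => fderiv ℝ Φ p (w, 0)) (x + u • w, t) - R))
      (Metric.closedBall (0 : ℝ) |s|) u := by
    intro u _
    have hc : HasDerivAt (fun u : ℝ => ((x + u • w, t) : E × V)) (w, 0) u := by
      have := (((hasDerivAt_id u).smul_const w).const_add x).prodMk (hasDerivAt_const u t)
      simpa using this
    have h1 := (hd (x + u • w, t)).hasFDerivAt.comp_hasDerivAt u hc
    rw [← fderiv_iteratedFDeriv_comm hΦ.1] at h1
    have h2 := (hasDerivAt_id u).smul_const R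
    rw [one_smul] at h2
    exact ((h1.sub h2).const_smul (‖t‖ ^ k)).hasDerivWithinAt
  have hbd : ∀ u ∈ Metric.closedBall (0 : ℝ) |s|, ‖‖t‖ ^ k •
      (iteratedFDeriv ℝ n (fun p : E × V => fderiv ℝ Φ p (w, 0)) (x + u • w, t) - R)‖ ≤
        C * ‖s • w‖ := by
    intro u hu
    have hu' : ‖u • w‖ ≤ ‖s • w‖ := by
      rw [norm_smul, norm_smul]
      gcongr
      simpa using hu
    rw [norm_smul, norm_pow, norm_norm]
    refine (h x (Metric.mem_ball_self hr) (x + u • w) ?_ t).trans ?_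
    · rw [mem_ball_iff_norm, add_sub_cancel_left]; exact hu'.trans_lt hs
    · rw [add_sub_cancel_left]; gcongr
  have hmv := (convex_closedBall (0 : ℝ) |s|).norm_image_sub_le_of_norm_hasDerivWithin_le hder hbd
    (Metric.mem_closedBall_self (abs_nonneg s)) (y := s) (by simp)
  have e : iteratedFDeriv ℝ n (⇑(s⁻¹ • (hΦ.slice (x + s • w) - hΦ.slice (x + (0 : ℝ) • w)) -
      hΦw.slice x)) t = (s⁻¹ • (iteratedFDeriv ℝ n Φ (x + s • w, t) - iteratedFDeriv ℝ n Φ (x, t)) -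
        R).compContinuousLinearMap fun _ => ContinuousLinearMap.inr ℝ E V := by
    have h0 : x + (0 : ℝ) • w = x := by simp
    rw [h0]
    have hsm : ∀ g : 𝓢(V, F), ContDiffAt ℝ n (⇑g) t := fun g => (g.smooth n).contDiffAt
    have e1 := iteratedFDeriv_sub_apply (𝕜 := ℝ) (hsm (s⁻¹ • (hΦ.slice (x + s • w) - hΦ.slice x)))
      (hsm (hΦw.slice x))
    have e2 := iteratedFDeriv_const_smul_apply (𝕜 := ℝ) (a := s⁻¹)
      (hsm (hΦ.slice (x + s • w) - hΦ.slice x))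
    have e3 := iteratedFDeriv_sub_apply (𝕜 := ℝ) (hsm (hΦ.slice (x + s • w))) (hsm (hΦ.slice x))
    refine e1.trans ?_
    rw [iteratedFDeriv_slice_apply]
    refine (congrArg (· - _) (e2.trans (congrArg (s⁻¹ • ·) e3))).trans ?_
    rw [iteratedFDeriv_slice_apply, iteratedFDeriv_slice_apply]
    rfl
  rw [e]
  have hfac : s⁻¹ • (iteratedFDeriv ℝ n Φ (x + s • w, t) - iteratedFDeriv ℝ n Φ (x, t)) - R =
      s⁻¹ • ((iteratedFDeriv ℝ n Φ (x + s • w, t) - s • R) -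
        (iteratedFDeriv ℝ n Φ (x + (0 : ℝ) • w, t) - (0 : ℝ) • R)) := by
    rw [zero_smul, zero_smul, add_zero, sub_zero, sub_right_comm, smul_sub _ _ (s • R), smul_smul,
      inv_mul_cancel₀ hs0', one_smul]
  rw [← smul_sub, norm_smul, norm_pow, norm_norm, sub_zero] at hmv
  calc _ ≤ ‖t‖ ^ k * ‖s⁻¹ • (iteratedFDeriv ℝ n Φ (x + s • w, t) - iteratedFDeriv ℝ n Φ (x, t)) - R‖ := by
        gcongr
        exact norm_compContinuousLinearMap_inr_le _
    _ = ‖s‖⁻¹ * (‖t‖ ^ k * ‖(iteratedFDeriv ℝ n Φ (x + s • w, t) - s • R) -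
        (iteratedFDeriv ℝ n Φ (x + (0 : ℝ) • w, t) - (0 : ℝ) • R)‖) := by
        rw [hfac, norm_smul, norm_inv]; ring
    _ ≤ ‖s‖⁻¹ * (C * ‖s • w‖ * ‖s‖) := by gcongr
    _ = C * ‖s • w‖ := by
        have : ‖s‖ ≠ 0 := norm_ne_zero_iff.2 hs0'
        field_simp

end IsSchwartzFamily

/-- The iterated derivatives of `Φ` in the parameter, as functions of the parameter, the directions
and the variable. -/
noncomputable def paramDeriv (Φ : E × V → F) : (k : ℕ) → (E × (Fin k → E)) × V → F
  | 0 => fun p => Φ (p.1.1, p.2)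
  | k + 1 => fun p => fderiv ℝ (paramDeriv Φ k) ((p.1.1, Fin.tail p.1.2), p.2) ((p.1.2 0, 0), 0)

/-- The directions count as parameters here, so continuity of the slices gives joint continuity in
the point and the directions. -/
theorem IsSchwartzFamily.paramDeriv {Φ : E × V → F} (hΦ : IsSchwartzFamily Φ) (k : ℕ) :
    IsSchwartzFamily (paramDeriv Φ k) := by
  induction k with
  | zero => exact hΦ.comp_param (ContinuousLinearMap.fst ℝ E (Fin 0 → E))
  | succ k ih =>
    let L : E × (Fin (k + 1) → E) →L[ℝ] E × (Fin k → E) :=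
      (ContinuousLinearMap.fst ℝ _ _).prod (ContinuousLinearMap.pi fun i =>
        (ContinuousLinearMap.proj i.succ).comp (ContinuousLinearMap.snd ℝ _ _))
    refine (ih.fderiv_right.comp_param L).clm_apply (u := fun q : E × (Fin (k + 1) → E) =>
      (((q.2 0, 0), 0) : (E × (Fin k → E)) × V)) ?_
    have : ContDiff ℝ ∞ fun q : E × (Fin (k + 1) → E) => q.2 0 :=
      ((ContinuousLinearMap.proj (R := ℝ) (φ := fun _ : Fin (k + 1) => E) 0).comp
        (ContinuousLinearMap.snd ℝ E (Fin (k + 1) → E))).contDiff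
    exact (this.prodMk contDiff_const).prodMk contDiff_const

/-- The Schwartz functions of a Schwartz family with values in a closed subspace depend smoothly
on the parameter. -/
theorem IsSchwartzFamily.isSmoothMap {V F : Type*} [NormedAddCommGroup V] [NormedSpace ℝ V]
    [NormedAddCommGroup F] [NormedSpace ℂ F] {Φ : E × V → F} (hΦ : IsSchwartzFamily Φ)
    {S : Submodule ℂ 𝓢(V, F)} (hS : IsClosed (S : Set 𝓢(V, F))) {f : E → S}
    (hf : ∀ x t, (f x).1 t = Φ (x, t)) : IsSmoothMap f := by
  have hder : ∀ k x (v : Fin k → E) w, HasDerivAtZero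
      (fun t : ℝ => (hΦ.paramDeriv k).slice (x + t • w, v))
      ((hΦ.paramDeriv (k + 1)).slice (x, Fin.cons w v)) := by
    intro k x v w
    have := (hΦ.paramDeriv k).hasDerivAtZero_slice (x, v) (w, 0)
      (T := (hΦ.paramDeriv (k + 1)).slice (x, Fin.cons w v)) (fun t => rfl)
    simpa using this
  -- Each derivative is a limit of difference quotients of the previous one, so closedness of `S`
  -- keeps all of them in `S`.
  have hmem : ∀ k x (v : Fin k → E), (hΦ.paramDeriv k).slice (x, v) ∈ S := by
    intro k
    induction k with
    | zero =>
      intro x v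
      have : (hΦ.paramDeriv 0).slice (x, v) = (f x).1 := by ext t; exact (hf x t).symm
      rw [this]; exact (f x).2
    | succ k ih =>
      intro x v
      rw [← Fin.cons_self_tail v]
      refine hS.mem_of_tendsto (hder k x (Fin.tail v) (v 0)) (Eventually.of_forall fun t => ?_)
      exact S.smul_of_tower_mem _ (S.sub_mem (ih _ _) (ih _ _))
  refine ⟨fun k x v => ⟨(hΦ.paramDeriv k).slice (x, v), hmem k x v⟩, ?_, ?_, ?_⟩
  · intro x v
    ext t
    exact (hf x t).symm
  · intro k x v w
    exact tendsto_subtype_rng.2 (hder k x v w)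
  · intro k
    exact (hΦ.paramDeriv k).continuous_slice.subtype_mk _

end SchwartzFamily

end SymCone

namespace SymCone

/-! ### Composition of a Schwartz function with affine maps depending on a parameter. -/

section AffineFamily

open scoped ContDiff
open Filter

variable {E V W F G : Type*} [NormedAddCommGroup E] [NormedSpace ℝ E]
  [NormedAddCommGroup V] [NormedSpace ℝ V] [NormedAddCommGroup W] [NormedSpace ℝ W]
  [NormedAddCommGroup F] [NormedSpace ℝ F] [NormedAddCommGroup G] [NormedSpace ℝ G]

theorem IsSchwartzFamily.clm_comp {Φ : E × V → F} (hΦ : IsSchwartzFamily Φ) (L : F →L[ℝ] G) :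
    IsSchwartzFamily fun p => L (Φ p) := by
  refine ⟨L.contDiff.comp hΦ.1, fun x₀ k n => ?_⟩
  obtain ⟨C, hC⟩ := hΦ.2 x₀ k n
  refine ⟨‖L‖ * C, ?_⟩
  filter_upwards [hC] with x hx t
  have h := L.norm_iteratedFDeriv_comp_left (x := (x, t)) (n := n) hΦ.1.contDiffAt
    (by norm_cast; exact le_top)
  calc _ ≤ ‖t‖ ^ k * (‖L‖ * ‖iteratedFDeriv ℝ n Φ (x, t)‖) := by gcongr; exact h
    _ = ‖L‖ * (‖t‖ ^ k * ‖iteratedFDeriv ℝ n Φ (x, t)‖) := by ring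
    _ ≤ _ := by gcongr; exact hx t

theorem IsSchwartzFamily.smul_param {Φ : E × V → F} (hΦ : IsSchwartzFamily Φ) {a : E → ℝ}
    (ha : ContDiff ℝ ∞ a) : IsSchwartzFamily fun p : E × V => a p.1 • Φ p :=
  (hΦ.clm_comp (ContinuousLinearMap.lsmul ℝ ℝ : ℝ →L[ℝ] F →L[ℝ] F).flip).clm_apply ha

/-- A crude bound covering all orders at once: linear growth for order `0`, a constant for order
`1`, zero beyond. -/
theorem norm_iteratedFDeriv_clm_le (L : E →L[ℝ] F) (n : ℕ) (p : E) :
    ‖iteratedFDeriv ℝ n L p‖ ≤ ‖L‖ * (1 + ‖p‖) := by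
  match n with
  | 0 =>
    rw [norm_iteratedFDeriv_zero]
    refine (L.le_opNorm p).trans ?_
    gcongr
    linarith
  | 1 =>
    rw [norm_iteratedFDeriv_one, L.fderiv]
    exact le_mul_of_one_le_right (norm_nonneg _) (by linarith [norm_nonneg p])
  | n + 2 =>
    have h : fderiv ℝ L = fun _ => L := funext fun _ => L.fderiv
    rw [← norm_iteratedFDeriv_fderiv, h, iteratedFDeriv_const_of_ne (Nat.succ_ne_zero n)]
    simp only [Pi.zero_apply, norm_zero]
    positivity

theorem norm_iteratedFDeriv_affine_eventually_le {B : E → V →L[ℝ] W} {b : E → W}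
    (hB : ContDiff ℝ ∞ B) (hb : ContDiff ℝ ∞ b) (x₀ : E) (n : ℕ) :
    ∃ C, 0 ≤ C ∧ ∀ᶠ x in 𝓝 x₀, ∀ t : V,
      ‖iteratedFDeriv ℝ n (fun p : E × V => B p.1 p.2 + b p.1) (x, t)‖ ≤ C * (1 + ‖t‖) := by
  have hB' : ContDiff ℝ ∞ fun p : E × V => B p.1 := hB.comp contDiff_fst
  have hb' : ContDiff ℝ ∞ fun p : E × V => b p.1 := hb.comp contDiff_fst
  choose A hA hA' using fun i =>
    IsSchwartzFamily.norm_iteratedFDeriv_param_eventually_le (V := V) hB x₀ i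
  obtain ⟨D, hD, hD'⟩ :=
    IsSchwartzFamily.norm_iteratedFDeriv_param_eventually_le (V := V) hb x₀ n
  have h1 : ∀ᶠ x in 𝓝 x₀, ∀ i ∈ Finset.range (n + 1), ∀ t : V,
      ‖iteratedFDeriv ℝ i (fun p : E × V => B p.1) (x, t)‖ ≤ A i :=
    (Filter.eventually_all_finset _).2 fun i _ => hA' i
  refine ⟨∑ i ∈ Finset.range (n + 1), (n.choose i : ℝ) * A i + D,
    add_nonneg (Finset.sum_nonneg fun i _ => mul_nonneg (by positivity) (hA i)) hD, ?_⟩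
  filter_upwards [h1, hD'] with x hx1 hx2 t
  have hadd := iteratedFDeriv_add_apply (𝕜 := ℝ) (i := n) (x := (x, t))
    (f := fun p : E × V => B p.1 p.2) (g := fun p : E × V => b p.1)
    ((hB'.clm_apply contDiff_snd).of_le (by norm_cast; exact le_top)).contDiffAt
    (hb'.of_le (by norm_cast; exact le_top)).contDiffAt
  change ‖iteratedFDeriv ℝ n ((fun p : E × V => B p.1 p.2) + fun p : E × V => b p.1) (x, t)‖ ≤ _
  rw [hadd, add_mul, Finset.sum_mul]
  refine (norm_add_le _ _).trans (add_le_add ?_ ?_)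
  · refine (norm_iteratedFDeriv_clm_apply hB' contDiff_snd (x, t) (n := n)
      (by norm_cast; exact le_top)).trans (Finset.sum_le_sum fun i hi => ?_)
    have hs : ‖iteratedFDeriv ℝ (n - i) (Prod.snd : E × V → V) (x, t)‖ ≤ 1 + ‖t‖ := by
      have h := norm_iteratedFDeriv_comp_clm_le (f := fun v : V => v) contDiff_id
        (ContinuousLinearMap.snd ℝ E V) (n - i) (x, t)
      refine h.trans ((mul_le_of_le_one_right (norm_nonneg _) (pow_le_one₀ (norm_nonneg _)
        (ContinuousLinearMap.norm_snd_le ℝ E V))).trans ?_)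
      refine (norm_iteratedFDeriv_clm_le (ContinuousLinearMap.id ℝ V) (n - i) t).trans ?_
      exact mul_le_of_le_one_left (by positivity) ContinuousLinearMap.norm_id_le
    have := hx1 i hi t
    have := hA i
    gcongr
  · exact (hx2 t).trans (le_mul_of_one_le_right hD (by linarith [norm_nonneg t]))

/-- Composing a Schwartz function with a smooth family of invertible affine maps gives a Schwartz
family. -/
theorem isSchwartzFamily_comp_affine (ψ : 𝓢(W, F)) {B : E → V →L[ℝ] W} {b : E → W}
    {B' : E → W →L[ℝ] V} (hB : ContDiff ℝ ∞ B) (hb : ContDiff ℝ ∞ b) (hB' : Continuous B')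
    (hinv : ∀ x v, B' x (B x v) = v) :
    IsSchwartzFamily fun p : E × V => ψ (B p.1 p.2 + b p.1) := by
  set Γ : E × V → W := fun p => B p.1 p.2 + b p.1 with hΓ
  have hΓs : ContDiff ℝ ∞ Γ :=
    ((hB.comp contDiff_fst).clm_apply contDiff_snd).add (hb.comp contDiff_fst)
  refine ⟨(ψ.smooth ⊤).comp hΓs, fun x₀ k n => ?_⟩
  choose A hA hA' using fun i => norm_iteratedFDeriv_affine_eventually_le hB hb x₀ i
  have h1 : ∀ᶠ x in 𝓝 x₀, ∀ i ∈ Finset.range (n + 1), ∀ t : V,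
      ‖iteratedFDeriv ℝ i Γ (x, t)‖ ≤ A i * (1 + ‖t‖) :=
    (Filter.eventually_all_finset _).2 fun i _ => hA' i
  -- `K` dominates every `A i` and is at least `1`, so `A i * (1 + ‖t‖)` is below `(K * (1 + ‖t‖)) ^
  -- i` for `i ≥ 1`, the form required by the bound for derivatives of a composition.
  set K : ℝ := 1 + ∑ i ∈ Finset.range (n + 1), A i with hK
  have hK1 : 1 ≤ K := by
    rw [hK]; linarith [Finset.sum_nonneg fun i (_ : i ∈ Finset.range (n + 1)) => hA i]
  -- Chosen so that solving `Γ (x, t) = B x t + b x` for `t` gives `1 + ‖t‖ ≤ M * (1 + ‖Γ (x, t)‖)`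
  -- for `x` near `x₀`.
  set M : ℝ := 1 + (‖B' x₀‖ + 1) * (‖b x₀‖ + 1) with hM
  have h2 : ∀ᶠ x in 𝓝 x₀, ‖B' x‖ < ‖B' x₀‖ + 1 :=
    hB'.norm.continuousAt.eventually (gt_mem_nhds (lt_add_one _))
  have h3 : ∀ᶠ x in 𝓝 x₀, ‖b x‖ < ‖b x₀‖ + 1 :=
    hb.continuous.norm.continuousAt.eventually (gt_mem_nhds (lt_add_one _))
  -- Of these powers of decay, `k` absorb the weight and `n` absorb the growth `(1 + ‖t‖) ^ n` of
  -- the inner derivatives.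
  set N : ℕ := k + n with hN
  set S : ℝ := 2 ^ N * ((Finset.Iic (N, n)).sup fun m => SchwartzMap.seminorm ℝ m.1 m.2) ψ with hS
  have hS0 : 0 ≤ S := by positivity
  refine ⟨n.factorial * (S * M ^ N) * K ^ n, ?_⟩
  filter_upwards [h1, h2, h3] with x hx1 hx2 hx3 t
  have hMt : 1 + ‖t‖ ≤ M * (1 + ‖Γ (x, t)‖) := by
    have e : t = B' x (Γ (x, t) - b x) := by simp [hΓ, hinv]
    have ht : ‖t‖ ≤ (‖B' x₀‖ + 1) * (‖Γ (x, t)‖ + (‖b x₀‖ + 1)) := by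
      conv_lhs => rw [e]
      refine ((B' x).le_opNorm _).trans ?_
      gcongr
      exact (norm_sub_le _ _).trans (by gcongr)
    have p1 : 0 ≤ ‖B' x₀‖ := norm_nonneg _
    have p2 : 0 ≤ ‖b x₀‖ := norm_nonneg _
    have p3 : 0 ≤ ‖Γ (x, t)‖ := norm_nonneg _
    have p4 : 0 ≤ (‖B' x₀‖ + 1) * ‖b x₀‖ * ‖Γ (x, t)‖ := by positivity
    rw [hM]
    nlinarith
  have hC : ∀ i ≤ n, ‖iteratedFDeriv ℝ i ψ (Γ (x, t))‖ ≤ S * M ^ N / (1 + ‖t‖) ^ N := by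
    intro i hi
    have h := SchwartzMap.one_add_le_sup_seminorm_apply (𝕜 := ℝ) (m := (N, n)) (k := N) (n := i)
      le_rfl hi ψ (Γ (x, t))
    rw [le_div_iff₀' (by positivity)]
    calc (1 + ‖t‖) ^ N * ‖iteratedFDeriv ℝ i ψ (Γ (x, t))‖
        ≤ (M * (1 + ‖Γ (x, t)‖)) ^ N * ‖iteratedFDeriv ℝ i ψ (Γ (x, t))‖ := by gcongr
      _ = M ^ N * ((1 + ‖Γ (x, t)‖) ^ N * ‖iteratedFDeriv ℝ i ψ (Γ (x, t))‖) := by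
        rw [mul_pow]; ring
      _ ≤ M ^ N * S := by gcongr
      _ = S * M ^ N := mul_comm _ _
  have hD : ∀ i, 1 ≤ i → i ≤ n → ‖iteratedFDeriv ℝ i Γ (x, t)‖ ≤ (K * (1 + ‖t‖)) ^ i := by
    intro i hi1 hi
    have hi' : i ∈ Finset.range (n + 1) := Finset.mem_range.2 (Nat.lt_succ_of_le hi)
    have hAK : A i ≤ K := by
      have := Finset.single_le_sum (f := A) (fun j _ => hA j) hi'
      rw [hK]; linarith
    refine (hx1 i hi' t).trans ?_
    refine (mul_le_mul_of_nonneg_right hAK (by positivity)).trans ?_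
    refine le_self_pow₀ ?_ (by lia)
    exact one_le_mul_of_one_le_of_one_le hK1 (by linarith [norm_nonneg t])
  have h := norm_iteratedFDeriv_comp_le (ψ.smooth ⊤) hΓs (n := n) (by norm_cast; exact le_top)
    (x, t) hC hD
  have hk : ‖t‖ ^ k ≤ (1 + ‖t‖) ^ k := by gcongr; linarith
  calc _ ≤ (1 + ‖t‖) ^ k * (n.factorial * (S * M ^ N / (1 + ‖t‖) ^ N) * (K * (1 + ‖t‖)) ^ n) := by
        gcongr
        exact h
    _ = _ := by
        rw [hN, mul_pow, pow_add (1 + ‖t‖)]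
        field_simp

end AffineFamily

/-! ### The determinant of an exponential. -/

section Det

variable {V : Type*} [NormedAddCommGroup V] [InnerProductSpace ℝ V] [FiniteDimensional ℝ V]

theorem differentiable_det : Differentiable ℝ fun A : V →L[ℝ] V => A.det := by
  let b := Module.finBasis ℝ V
  have e : (fun A : V →L[ℝ] V => A.det) = fun A : V →L[ℝ] V =>
      ∑ σ : Equiv.Perm (Fin (Module.finrank ℝ V)), (Equiv.Perm.sign σ : ℤ) •
        ∏ i, LinearMap.toMatrix b b A.toLinearMap (σ i) i := by
    funext A
    rw [ContinuousLinearMap.det, ← LinearMap.det_toMatrix b, Matrix.det_apply]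
    rfl
  have hent : ∀ i j, ContDiff ℝ 1 fun A : V →L[ℝ] V =>
      LinearMap.toMatrix b b A.toLinearMap i j := by
    intro i j
    let ℓ : (V →L[ℝ] V) →ₗ[ℝ] ℝ :=
      { toFun := fun A => LinearMap.toMatrix b b A.toLinearMap i j
        map_add' := fun A B => by simp
        map_smul' := fun c A => by simp }
    exact (LinearMap.toContinuousLinearMap ℓ).contDiff
  rw [e]
  refine Differentiable.fun_sum fun σ _ => Differentiable.fun_const_smul ?_ _
  exact (contDiff_prod fun i _ => hent (σ i) i).differentiable (by simp)

/-- In a basis this is the linear coefficient of the polynomial `det (1 + X M)`. -/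
theorem hasDerivAt_det_one_add_smul (Y : V →L[ℝ] V) :
    HasDerivAt (fun s : ℝ => (1 + s • Y).det) (LinearMap.trace ℝ V Y.toLinearMap) 0 := by
  let b := Module.finBasis ℝ V
  set M := LinearMap.toMatrix b b Y.toLinearMap with hM
  have h := (Matrix.det (1 + (Polynomial.X : Polynomial ℝ) • M.map Polynomial.C)).hasDerivAt 0
  rw [Matrix.derivative_det_one_add_X_smul, ← LinearMap.trace_eq_matrix_trace] at h
  refine h.congr_deriv rfl |>.congr_of_eventuallyEq (Filter.Eventually.of_forall fun s => ?_)
  change (1 + s • Y).det = Polynomial.eval s _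
  rw [ContinuousLinearMap.det, ← LinearMap.det_toMatrix b, ← Polynomial.coe_evalRingHom,
    RingHom.map_det]
  congr 1
  have e1 : ((1 + s • Y : V →L[ℝ] V) : V →ₗ[ℝ] V) = 1 + s • Y.toLinearMap := rfl
  rw [e1, map_add, map_smul, LinearMap.toMatrix_one]
  ext i j
  simp [hM, Matrix.one_apply, apply_ite]
  ring

/-- The function `f s = det (exp (s Y))` is multiplicative with derivative `tr Y` at `0`, hence
solves `f' = (tr Y) f`; so `f s * e^{-s tr Y}` is constant. -/
theorem det_exp (Y : V →L[ℝ] V) :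
    (NormedSpace.exp Y).det = Real.exp (LinearMap.trace ℝ V Y.toLinearMap) := by
  set τ := LinearMap.trace ℝ V Y.toLinearMap with hτ
  set f : ℝ → ℝ := fun s => (NormedSpace.exp (s • Y)).det with hf
  have h0 : HasDerivAt f τ 0 := by
    have h1 := hasDerivAt_exp_smul_const (𝕂 := ℝ) Y (0 : ℝ)
    have hd : HasFDerivAt (fun A : V →L[ℝ] V => A.det)
        (fderiv ℝ (fun A : V →L[ℝ] V => A.det) 1) 1 := (differentiable_det 1).hasFDerivAt
    have e0 : NormedSpace.exp ((0 : ℝ) • Y) = 1 := by simp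
    have h2 : HasDerivAt f (fderiv ℝ (fun A : V →L[ℝ] V => A.det) 1 Y) 0 := by
      rw [e0, one_mul] at h1
      rw [← e0] at hd
      have := hd.comp_hasDerivAt (0 : ℝ) h1
      rwa [e0] at this
    -- The curves `exp (s Y)` and `1 + s Y` have the same tangent at the identity, so the derivative
    -- of `det` can be computed along the second.
    have h3 : HasDerivAt (fun s : ℝ => (1 + s • Y).det)
        (fderiv ℝ (fun A : V →L[ℝ] V => A.det) 1 Y) 0 := by
      have hl : HasDerivAt (fun s : ℝ => 1 + s • Y) Y 0 := by
        simpa using ((hasDerivAt_id (0 : ℝ)).smul_const Y).const_add 1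
      have e1 : (1 : V →L[ℝ] V) + (0 : ℝ) • Y = 1 := by simp
      rw [← e1] at hd
      have := hd.comp_hasDerivAt (0 : ℝ) hl
      rwa [e1] at this
    rwa [h3.unique (hasDerivAt_det_one_add_smul Y)] at h2
  have hmul : ∀ s u, f (s + u) = f s * f u := by
    intro s u
    simp only [hf]
    rw [exp_add_smul, ContinuousLinearMap.det, ContinuousLinearMap.toLinearMap_mul, map_mul]
  have hder : ∀ s, HasDerivAt f (f s * τ) s := by
    intro s
    have h' : HasDerivAt (fun u => f s * f (u - s)) (f s * τ) s := by
      have h00 : HasDerivAt f τ (s - s) := by rwa [sub_self]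
      exact (h00.comp_sub_const s s).const_mul (f s)
    refine h'.congr_of_eventuallyEq (Filter.Eventually.of_forall fun u => ?_)
    change f u = f s * f (u - s)
    rw [← hmul, add_sub_cancel]
  have hconst : ∀ s, HasDerivAt (fun s => f s * Real.exp (-(s * τ))) 0 s := by
    intro s
    have h2 : HasDerivAt (fun s : ℝ => Real.exp (-(s * τ))) (Real.exp (-(s * τ)) * -(1 * τ)) s :=
      (((hasDerivAt_id s).mul_const τ).neg).exp
    exact ((hder s).mul h2).congr_deriv (by ring)
  have h := is_const_of_deriv_eq_zero (fun s => (hconst s).differentiableAt)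
    (fun s => (hconst s).deriv) 1 0
  have hf0 : f 0 = 1 := by
    simp [hf, ContinuousLinearMap.det, ContinuousLinearMap.toLinearMap_one]
  have hf1 : f 1 = (NormedSpace.exp Y).det := by simp [hf]
  simp only [one_mul, zero_mul, neg_zero, Real.exp_zero, mul_one, hf0, hf1, Real.exp_neg] at h
  exact (mul_inv_eq_one₀ (Real.exp_ne_zero _)).1 h

theorem one_div_sqrt_det_exp (Y : V →L[ℝ] V) : 1 / √(NormedSpace.exp Y).det =
    Real.exp (-(LinearMap.trace ℝ V Y.toLinearMap) / 2) := by
  rw [det_exp, Real.sqrt_eq_rpow, ← Real.exp_mul, one_div, ← Real.exp_neg]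
  congr 1
  ring

end Det

/-! ### Closedness of `𝒮_Ω`. -/

section Closed

variable {V : Type*} [NormedAddCommGroup V] [InnerProductSpace ℝ V] [FiniteDimensional ℝ V]
  [MeasurableSpace V] [BorelSpace V]

open scoped FourierTransform in
-- Passing to the kernel `e^{-2πi⟨x, w⟩}` makes continuity of the Fourier transform on Schwartz
-- space available.
theorem fourierV_eq (f : 𝓢(V, ℂ)) (w : V) :
    fourierV f w = (((2 * Real.pi) ^ (-(Module.finrank ℝ V : ℝ) / 2) : ℝ) : ℂ) *
      𝓕 f ((2 * Real.pi)⁻¹ • w) := by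
  rw [fourierV, SchwartzMap.fourier_coe, Real.fourier_eq']
  congr 1
  refine MeasureTheory.integral_congr_ae (Filter.Eventually.of_forall fun x => ?_)
  have h : -2 * Real.pi * inner ℝ x ((2 * Real.pi)⁻¹ • w) = -inner ℝ x w := by
    rw [inner_smul_right]
    have := Real.pi_ne_zero
    field_simp
  change _ = Complex.exp (((-2 * Real.pi * inner ℝ x ((2 * Real.pi)⁻¹ • w) : ℝ) : ℂ) * Complex.I) •
    f x
  have e : -(Complex.I * (inner ℝ x w : ℝ)) = ((-inner ℝ x w : ℝ) : ℂ) * Complex.I := by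
    push_cast; ring
  rw [h, smul_eq_mul, ← e, mul_comm]

/-- An intersection of zero sets of the functionals `f ↦ f̂(w)`, each continuous as a Fourier
transform followed by a point evaluation. -/
theorem isClosed_schwartzCone (Ω : SymmetricCone V) :
    IsClosed (SchwartzCone Ω : Set 𝓢(V, ℂ)) := by
  have e : (SchwartzCone Ω : Set 𝓢(V, ℂ)) =
      ⋂ (w : V) (_ : w ∉ Ω.carrier), {f : 𝓢(V, ℂ) | fourierV f w = 0} := by
    ext f; simp [SchwartzCone]
  rw [e]
  refine isClosed_iInter fun w => isClosed_iInter fun _ => isClosed_eq ?_ continuous_const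
  simp only [fourierV_eq]
  refine continuous_const.mul ?_
  have h1 : Continuous fun f : 𝓢(V, ℂ) =>
      SchwartzMap.toBoundedContinuousFunctionCLM ℂ V ℂ f ((2 * Real.pi)⁻¹ • w) :=
    (BoundedContinuousFunction.evalCLM ℂ ((2 * Real.pi)⁻¹ • w)).continuous.comp
      (SchwartzMap.toBoundedContinuousFunctionCLM ℂ V ℂ).continuous
  exact h1.comp ContinuousFourier.continuous_fourier

end Closed

end SymCone

namespace SymCone

open scoped ContDiff

theorem IsSmoothMap.clm_comp {E F : Type*} [NormedAddCommGroup E] [NormedSpace ℝ E]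
    [AddCommGroup F] [Module ℝ F] [Module ℂ F] [IsScalarTower ℝ ℂ F] [TopologicalSpace F]
    {f : E → F} (hf : IsSmoothMap f) (T : F →L[ℂ] F) : IsSmoothMap fun x => T (f x) := by
  obtain ⟨D, h0, h1, h2⟩ := hf
  refine ⟨fun k x v => T (D k x v), fun x v => congrArg T (h0 x v), fun k x v w => ?_, fun k =>
    T.continuous.comp (h2 k)⟩
  have h := (T.continuous.tendsto _).comp (h1 k x v w)
  refine h.congr fun t => ?_
  change T (t⁻¹ • (_ - _)) = t⁻¹ • (_ - _)
  rw [← map_sub]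
  exact (T : F →ₗ[ℂ] F).map_smul_of_tower _ _

/-! ### Smoothness of the exponential, the trace and the integral in `exp (s X)`. -/

section Curves

variable {V : Type*} [NormedAddCommGroup V] [InnerProductSpace ℝ V] [FiniteDimensional ℝ V]

theorem contDiff_exp_clm : ContDiff ℝ ∞ (NormedSpace.exp : (V →L[ℝ] V) → (V →L[ℝ] V)) :=
  AnalyticOnNhd.contDiff fun X _ => NormedSpace.exp_analytic (𝕂 := ℝ) X

/-- The trace of an endomorphism, as a continuous linear functional. -/
noncomputable def traceCLM : (V →L[ℝ] V) →L[ℝ] ℝ :=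
  LinearMap.toContinuousLinearMap ((LinearMap.trace ℝ V).comp (ContinuousLinearMap.coeLM ℝ))

theorem traceCLM_apply (Y : V →L[ℝ] V) : traceCLM Y = LinearMap.trace ℝ V Y.toLinearMap := rfl

theorem traceCLM_lie (Y Z : V →L[ℝ] V) : traceCLM ⁅Y, Z⁆ = 0 := by
  rw [LieRing.of_associative_ring_bracket, map_sub, sub_eq_zero]
  exact LinearMap.trace_mul_comm ℝ Y.toLinearMap Z.toLinearMap

theorem hasDerivAt_integral_exp (Y : V →L[ℝ] V) (v : V) (s : ℝ) :
    HasDerivAt (fun r : ℝ => ∫ u in (0 : ℝ)..r, NormedSpace.exp (u • Y) v)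
      (NormedSpace.exp (s • Y) v) s :=
  intervalIntegral.integral_hasDerivAt_right
    ((continuous_exp_smul_apply Y v).intervalIntegrable _ _)
    (continuous_exp_smul_apply Y v).aestronglyMeasurable.stronglyMeasurableAtFilter
    (continuous_exp_smul_apply Y v).continuousAt

theorem contDiff_exp_smul (Y : V →L[ℝ] V) : ContDiff ℝ ∞ fun s : ℝ => NormedSpace.exp (s • Y) :=
  contDiff_exp_clm.comp (contDiff_id.smul contDiff_const)

theorem contDiff_integral_exp (Y : V →L[ℝ] V) (v : V) :
    ContDiff ℝ ∞ fun r : ℝ => ∫ u in (0 : ℝ)..r, NormedSpace.exp (u • Y) v := by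
  refine contDiff_infty_iff_deriv.2
    ⟨fun s => (hasDerivAt_integral_exp Y v s).differentiableAt, ?_⟩
  rw [funext fun s => (hasDerivAt_integral_exp Y v s).deriv]
  exact (contDiff_exp_smul Y).clm_apply contDiff_const

theorem integral_exp_smul {V : Type*} [NormedAddCommGroup V] [NormedSpace ℝ V]
    (Y : V →L[ℝ] V) (v : V) (r : ℝ) :
    (∫ s in (0 : ℝ)..1, NormedSpace.exp (s • r • Y) (r • v)) =
      ∫ u in (0 : ℝ)..r, NormedSpace.exp (u • Y) v := by
  have h := intervalIntegral.smul_integral_comp_mul_right (a := 0) (b := 1)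
    (fun u : ℝ => NormedSpace.exp (u • Y) v) r
  rw [zero_mul, one_mul] at h
  rw [← h, ← intervalIntegral.integral_smul]
  refine intervalIntegral.integral_congr fun s _ => ?_
  change NormedSpace.exp (s • r • Y) (r • v) = r • NormedSpace.exp ((s * r) • Y) v
  rw [map_smul, smul_smul]

theorem exp_apply_exp_neg_apply (Y : V →L[ℝ] V) (v : V) :
    NormedSpace.exp Y (NormedSpace.exp (-Y) v) = v :=
  congrArg (fun A : V →L[ℝ] V => A v) (exp_mul_exp_neg Y)

end Curves

/-! ### Smooth vectors and the derived representation. -/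

section Representation

variable {V : Type*} [NormedAddCommGroup V] [InnerProductSpace ℝ V] [FiniteDimensional ℝ V]
  [MeasurableSpace V] [BorelSpace V]

theorem quasiRegular_expUnit_apply (Y : V →L[ℝ] V) (x : V) (f : 𝓢(V, ℂ)) (t : V) :
    quasiRegular (expUnit Y) x f t =
      Real.exp (-traceCLM Y / 2) • f (NormedSpace.exp (-Y) t + -NormedSpace.exp (-Y) x) := by
  rw [quasiRegular_apply, traceCLM_apply, ← one_div_sqrt_det_exp, Complex.real_smul,
    ← sub_eq_add_neg, ← map_sub]
  rfl

namespace IwasawaDatum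

variable {Ω : SymmetricCone V} (I : IwasawaDatum Ω)

/-- The projection of `𝔤 = 𝔥 ⋉ V` to `𝔥`, with values in the endomorphisms of `V`. -/
noncomputable def endPart : I.𝔤 →L[ℝ] (V →L[ℝ] V) :=
  LinearMap.mkContinuous
    { toFun := fun X => X.1.1
      map_add' := fun _ _ => rfl
      map_smul' := fun _ _ => rfl } 1
    fun X => by rw [one_mul]; exact norm_fst_le (X : I.𝔥 × V)

/-- The projection of `𝔤 = 𝔥 ⋉ V` to `V`. -/
noncomputable def vecPart : I.𝔤 →L[ℝ] V :=
  LinearMap.mkContinuous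
    { toFun := fun X => X.2
      map_add' := fun _ _ => rfl
      map_smul' := fun _ _ => rfl } 1
    fun X => by rw [one_mul]; exact norm_snd_le (X : I.𝔥 × V)

/-- Near the identity the orbit is a Schwartz family of affine substitutions with inverse linear
part `exp Y`, times the smooth scalar `e^{-tr Y/2}`. Left translation by `g` becomes the continuous
operator `π(g)`. -/
theorem isSmoothVector (ψ : SchwartzCone Ω) : I.IsSmoothVector ψ := by
  intro g
  have hB : ContDiff ℝ ∞ fun X : I.𝔤 => NormedSpace.exp (-I.endPart X) :=
    contDiff_exp_clm.comp I.endPart.contDiff.neg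
  have hfam := (isSchwartzFamily_comp_affine ψ.1 hB (hB.clm_apply I.vecPart.contDiff).neg
    (contDiff_exp_clm.comp I.endPart.contDiff).continuous
    (fun X v => exp_apply_exp_neg_apply (I.endPart X) v)).smul_param
    (a := fun X : I.𝔤 => Real.exp (-traceCLM (I.endPart X) / 2))
    (((traceCLM.contDiff.comp I.endPart.contDiff).neg.div_const 2).exp)
  have hs : IsSmoothMap fun X : I.𝔤 =>
      I.rep (I.mkG ⟨expUnit X.1.1, Subgroup.subset_closure ⟨X.1.1, X.1.2, rfl⟩⟩ X.2) ψ :=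
    hfam.isSmoothMap (isClosed_schwartzCone Ω) fun X t =>
      quasiRegular_expUnit_apply X.1.1 X.2 ψ.1 t
  have h := hs.clm_comp (I.rep g)
  have e : (fun X : I.𝔤 => I.rep (I.chart g X) ψ) = fun X : I.𝔤 => I.rep g
      (I.rep (I.mkG ⟨expUnit X.1.1, Subgroup.subset_closure ⟨X.1.1, X.1.2, rfl⟩⟩ X.2) ψ) := by
    funext X
    rw [chart, map_mul]
    rfl
  rwa [e]

theorem rep_expG_smul_apply (X : I.𝔤) (ψ : SchwartzCone Ω) (s : ℝ) (t : V) :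
    (I.rep (I.expG (s • X)) ψ).1 t = Real.exp (-traceCLM (s • X.1.1) / 2) •
      ψ.1 (NormedSpace.exp (-(s • X.1.1)) t + -NormedSpace.exp (-(s • X.1.1))
        (∫ u in (0 : ℝ)..s, NormedSpace.exp (u • X.1.1) X.2)) := by
  rw [← integral_exp_smul]
  exact quasiRegular_expUnit_apply (s • X.1.1) _ ψ.1 t

/-- Existence comes from the Schwartz family along the one-parameter subgroup, and membership in
`𝒮_Ω` from closedness. The pointwise formula is recorded because it reduces all later identities to
calculus at a point `t`. -/
theorem exists_hasDerivAtZero (X : I.𝔤) (ψ : SchwartzCone Ω) :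
    ∃ φ : SchwartzCone Ω, HasDerivAtZero (fun s : ℝ => I.rep (I.expG (s • X)) ψ) φ ∧
      ∀ t, φ.1 t = (-traceCLM X.1.1 / 2) • ψ.1 t - fderiv ℝ ψ.1 t (X.1.1 t + X.2) := by
  set Y : V →L[ℝ] V := X.1.1 with hY
  set c : ℝ → V := fun s => ∫ u in (0 : ℝ)..s, NormedSpace.exp (u • Y) X.2 with hc
  have hB : ContDiff ℝ ∞ fun s : ℝ => NormedSpace.exp (-(s • Y)) :=
    contDiff_exp_clm.comp (contDiff_id.smul contDiff_const).neg
  have hsY : ContDiff ℝ ∞ fun s : ℝ => s • Y := contDiff_id.smul contDiff_const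
  have htr : ContDiff ℝ ∞ fun s : ℝ => traceCLM (s • Y) := (traceCLM (V := V)).contDiff.comp hsY
  have hfam := (isSchwartzFamily_comp_affine ψ.1 hB
    (hB.clm_apply (contDiff_integral_exp Y X.2)).neg
    (contDiff_exp_smul Y).continuous
    (fun s v => exp_apply_exp_neg_apply (s • Y) v)).smul_param
    (a := fun s : ℝ => Real.exp (-traceCLM (s • Y) / 2))
    ((htr.neg.div_const 2).exp)
  set T := (hfam.fderiv_right.clm_apply (contDiff_const (c := ((1, 0) : ℝ × V)))).slice 0 with hT
  have hder := hfam.hasDerivAtZero_slice (0 : ℝ) 1 (T := T) fun t => rfl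
  have hval : ∀ s : ℝ, hfam.slice (0 + s • (1 : ℝ)) = (I.rep (I.expG (s • X)) ψ).1 := by
    intro s
    ext t
    rw [I.rep_expG_smul_apply, smul_eq_mul, mul_one, zero_add]
    rfl
  simp only [hval] at hder
  have hmem : T ∈ SchwartzCone Ω :=
    (isClosed_schwartzCone Ω).mem_of_tendsto hder (Filter.Eventually.of_forall fun s =>
      (SchwartzCone Ω).smul_of_tower_mem _ ((SchwartzCone Ω).sub_mem (I.rep _ ψ).2 (I.rep _ ψ).2))
  refine ⟨⟨T, hmem⟩, tendsto_subtype_rng.2 hder, fun t => ?_⟩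
  have hγ : HasDerivAt (fun s : ℝ => ((s, t) : ℝ × V)) (1, 0) 0 :=
    (hasDerivAt_id (0 : ℝ)).prodMk (hasDerivAt_const 0 t)
  have h1 := (hfam.1.differentiable (by simp) (0, t)).hasFDerivAt.comp_hasDerivAt (0 : ℝ) hγ
  have hE : HasDerivAt (fun s : ℝ => NormedSpace.exp (-(s • Y))) (-Y) 0 := by
    simpa using hasDerivAt_exp_smul_const (𝕂 := ℝ) (-Y) (0 : ℝ)
  have hc0 : c 0 = 0 := intervalIntegral.integral_same
  have hc' : HasDerivAt c X.2 0 := by simpa using hasDerivAt_integral_exp Y X.2 0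
  -- As `c 0 = 0`, differentiating the exponential in front of `c s` contributes nothing at `s = 0`.
  have hA : HasDerivAt (fun s : ℝ => NormedSpace.exp (-(s • Y)) t + -NormedSpace.exp (-(s • Y)) (c s))
      (-(Y t + X.2)) 0 := by
    have := (hE.clm_apply (hasDerivAt_const (0 : ℝ) t)).add (hE.clm_apply hc').neg
    refine this.congr_deriv ?_
    simp [hc0]
    abel
  have hA0 : NormedSpace.exp (-((0 : ℝ) • Y)) t + -NormedSpace.exp (-((0 : ℝ) • Y)) (c 0) = t := by
    simp [hc0]
  have hψ : HasFDerivAt ψ.1 (fderiv ℝ ψ.1 t)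
      (NormedSpace.exp (-((0 : ℝ) • Y)) t + -NormedSpace.exp (-((0 : ℝ) • Y)) (c 0)) := by
    rw [hA0]; exact ψ.1.differentiableAt.hasFDerivAt
  have hcomp := hψ.comp_hasDerivAt (0 : ℝ) hA
  have ha : HasDerivAt (fun s : ℝ => Real.exp (-traceCLM (s • Y) / 2)) (-traceCLM Y / 2) 0 := by
    have hl : HasDerivAt (fun s : ℝ => -traceCLM (s • Y) / 2) (-traceCLM Y / 2) 0 := by
      have := (((hasDerivAt_id (0 : ℝ)).smul_const (traceCLM Y)).neg).div_const 2
      simpa using this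
    simpa using hl.exp
  have h2 := ha.smul hcomp
  have h3 := h1.unique h2
  refine h3.trans ?_
  simp only [Function.comp_apply, hA0]
  simp [sub_eq_add_neg, add_comm]

/-- The operator `π^∞(X)` on `𝒮_Ω`. -/
noncomputable def derivedOp (X : I.𝔤) : Module.End ℂ (SchwartzCone Ω) where
  toFun ψ := (I.exists_hasDerivAtZero X ψ).choose
  map_add' ψ φ := by
    ext t
    have h := fun χ => (I.exists_hasDerivAtZero X χ).choose_spec.2 t
    have e : fderiv ℝ (ψ + φ).1 t = fderiv ℝ ψ.1 t + fderiv ℝ φ.1 t :=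
      fderiv_add ψ.1.differentiableAt φ.1.differentiableAt
    have e' : (ψ + φ).1 t = ψ.1 t + φ.1 t := rfl
    change _ = (I.exists_hasDerivAtZero X ψ).choose.1 t + (I.exists_hasDerivAtZero X φ).choose.1 t
    rw [h, h, h, e, e', smul_add, add_apply]
    abel
  map_smul' a ψ := by
    ext t
    have h := fun χ => (I.exists_hasDerivAtZero X χ).choose_spec.2 t
    have e : fderiv ℝ (a • ψ).1 t = a • fderiv ℝ ψ.1 t :=
      fderiv_const_smul ψ.1.differentiableAt a
    have e' : (a • ψ).1 t = a • ψ.1 t := rfl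
    change _ = a • (I.exists_hasDerivAtZero X ψ).choose.1 t
    rw [h, h, e, e', smul_sub, smul_comm]
    rfl

theorem hasDerivAtZero_derivedOp (X : I.𝔤) (ψ : SchwartzCone Ω) :
    HasDerivAtZero (fun s : ℝ => I.rep (I.expG (s • X)) ψ) (I.derivedOp X ψ) :=
  (I.exists_hasDerivAtZero X ψ).choose_spec.1

theorem derivedOp_apply (X : I.𝔤) (ψ : SchwartzCone Ω) (t : V) : (I.derivedOp X ψ).1 t =
    (-traceCLM X.1.1 / 2) • ψ.1 t - fderiv ℝ ψ.1 t (X.1.1 t + X.2) :=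
  (I.exists_hasDerivAtZero X ψ).choose_spec.2 t

/-- The product rule yields a second-derivative term and a term from the linear vector field; these
are needed to compute commutators of the derived operators. -/
theorem fderiv_derivedOp (X : I.𝔤) (ψ : SchwartzCone Ω) (t u : V) :
    fderiv ℝ (I.derivedOp X ψ).1 t u = (-traceCLM X.1.1 / 2) • fderiv ℝ ψ.1 t u -
      (fderiv ℝ (fderiv ℝ ψ.1) t u (X.1.1 t + X.2) + fderiv ℝ ψ.1 t (X.1.1 u)) := by
  have e : ⇑(I.derivedOp X ψ).1 = fun t =>
      (-traceCLM X.1.1 / 2) • ψ.1 t - fderiv ℝ ψ.1 t (X.1.1 t + X.2) :=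
    funext (I.derivedOp_apply X ψ)
  have hψ : HasFDerivAt ψ.1 (fderiv ℝ ψ.1 t) t := ψ.1.differentiableAt.hasFDerivAt
  have hd : HasFDerivAt (fderiv ℝ ψ.1) (fderiv ℝ (fderiv ℝ ψ.1) t) t :=
    (((ψ.1.smooth 2).fderiv_right (m := 1) (by norm_num)).differentiable (by simp) t).hasFDerivAt
  have h := (hψ.const_smul (-traceCLM X.1.1 / 2)).sub
    (hd.clm_apply ((X.1.1.hasFDerivAt (x := t)).add_const X.2))
  rw [e]
  have h' := congrArg (fun A : V →L[ℝ] ℂ => A u) h.fderiv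
  refine h'.trans ?_
  simp [add_comm]

/-- The derived representation `X ↦ π^∞(X)` of `𝔤` on `𝒮_Ω`. -/
noncomputable def derivedRep : I.𝔤 →ₗ⁅ℝ⁆ Module.End ℂ (SchwartzCone Ω) where
  toFun := I.derivedOp
  map_add' X X' := by
    ext ψ t
    change (I.derivedOp (X + X') ψ).1 t = (I.derivedOp X ψ).1 t + (I.derivedOp X' ψ).1 t
    have e1 : (X + X').1.1 = X.1.1 + X'.1.1 := rfl
    have e2 : (X + X').2 = X.2 + X'.2 := rfl
    rw [derivedOp_apply, derivedOp_apply, derivedOp_apply, e1, e2]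
    simp only [map_add, add_apply, Complex.real_smul]
    push_cast
    ring
  map_smul' a X := by
    ext ψ t
    change (I.derivedOp (a • X) ψ).1 t = a • (I.derivedOp X ψ).1 t
    have e1 : (a • X).1.1 = a • X.1.1 := rfl
    have e2 : (a • X).2 = a • X.2 := rfl
    rw [derivedOp_apply, derivedOp_apply, e1, e2]
    simp only [map_smul, map_add, smul_apply, Complex.real_smul, smul_eq_mul]
    push_cast
    ring
  -- In the commutator the second-derivative terms cancel by symmetry and the trace terms cancel in
  -- pairs. What remains is `-Dψ` applied to the commutator of the affine fields, `[Y, Y'] t + Y v'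
  -- - Y' v`, in agreement with the bracket of `𝔤` since `tr [Y, Y'] = 0`.
  map_lie' {X X'} := by
    ext ψ t
    change (I.derivedOp ⁅X, X'⁆ ψ).1 t =
      (I.derivedOp X (I.derivedOp X' ψ)).1 t - (I.derivedOp X' (I.derivedOp X ψ)).1 t
    have e1 : (⁅X, X'⁆ : I.𝔤).1.1 = ⁅X.1.1, X'.1.1⁆ := rfl
    have e2 : (⁅X, X'⁆ : I.𝔤).2 = X.1.1 X'.2 - X'.1.1 X.2 := rfl
    have e3 : ⁅X.1.1, X'.1.1⁆ t = X.1.1 (X'.1.1 t) - X'.1.1 (X.1.1 t) := rfl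
    have hs : IsSymmSndFDerivAt ℝ ψ.1 t :=
      ((ψ.1.smooth ⊤).contDiffAt).isSymmSndFDerivAt
        (by simpa using WithTop.coe_le_coe.2 (le_top : (2 : ℕ∞) ≤ ⊤))
    have hs' := hs.eq (X.1.1 t + X.2) (X'.1.1 t + X'.2)
    rw [derivedOp_apply, I.derivedOp_apply X (I.derivedOp X' ψ),
      I.derivedOp_apply X' (I.derivedOp X ψ), fderiv_derivedOp, fderiv_derivedOp,
      I.derivedOp_apply X ψ, I.derivedOp_apply X' ψ, e1, e2, traceCLM_lie, e3, hs']
    simp only [map_add, map_sub, add_apply, Complex.real_smul]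
    push_cast
    ring

end IwasawaDatum

end Representation

end SymCone

theorem mainTheorem6 {V : Type*} [NormedAddCommGroup V] [InnerProductSpace ℝ V]
    [FiniteDimensional ℝ V] [MeasurableSpace V] [BorelSpace V]
    (Ω : SymCone.SymmetricCone V) (I : SymCone.IwasawaDatum Ω) :
    {ψ : SymCone.SchwartzCone Ω | I.IsSmoothVector ψ} = Set.univ ∧
    ∃ dπ : I.𝔤 →ₗ⁅ℝ⁆ Module.End ℂ (SymCone.SchwartzCone Ω),
      (∀ (X : I.𝔤) (ψ : SymCone.SchwartzCone Ω),
        SymCone.HasDerivAtZero (fun t : ℝ => I.rep (I.expG (t • X)) ψ) (dπ X ψ)) ∧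
      ∃! ρ : UniversalEnvelopingAlgebra ℝ I.𝔤 →ₐ[ℝ] Module.End ℂ (SymCone.SchwartzCone Ω),
        ∀ X : I.𝔤, ρ (UniversalEnvelopingAlgebra.ι ℝ X) = dπ X := by
  refine ⟨Set.eq_univ_of_forall I.isSmoothVector, I.derivedRep, I.hasDerivAtZero_derivedOp,
    UniversalEnvelopingAlgebra.lift ℝ I.derivedRep,
    UniversalEnvelopingAlgebra.lift_ι_apply ℝ I.derivedRep, fun ρ hρ => ?_⟩
  exact (UniversalEnvelopingAlgebra.lift_unique ℝ I.derivedRep ρ).1 (funext hρ)
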